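/- **Setting.** Let $M$ be a closed Riemannian manifold of dimension $N$ and $E$ a smooth Hermitian complex vector bundle of rank $d$ over $M$. Let $K_0$ be a smooth triangulation of $M$: a finite simplicial complex in a finite-dimensional real vector space with a homeomorphism of its polyhedron onto $M$ that is smooth with injective differential on each closed simplex. Let $\{U_l\}$ be a finite open cover of $M$ such that each $\overline U_l$ is a subcomplex of $K_0$ and $E|_{\overline U_l}$ has a smooth frame $(e_{l,1},\dots,e_{l,d})$, fixed from now on. Let $\psi_l\ge 0$ be smooth functions on $M$ with $\operatorname{supp}\psi_l\subset U_l$ and $\sum_l\psi_l^2=1$, and let $i_l:E|_{\overline U_l}\to V_l=\overline U_l\times\mathbb C^{n_l}$ be smooth fibrewise isometric complex linear embeddings. Put $V=\bigoplus_l V_l$ (the trivial Hermitian bundle with fibre $\bigoplus_l\mathbb C^{n_l}$) and $i=\sum_l\psi_l i_l:E\to V$, an isometric embedding, with fibrewise adjoint $i^*$. For a finite subdivision $K$ of $K_0$, choose an orientation of every simplex and a reference point $p_\sigma$ in the interior of every simplex $\sigma$ of $K$. Let $C^q(K,E)$ be the space of functions $c$ assigning to each $q$-simplex $\sigma$ of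 $K$ a vector $c(\sigma)\in E_{p_\sigma}$. For a function $f$ defined at the vertices, let $R^Kf$ be the $0$-cochain $v\mapsto f(v)$; for a $0$-cochain $a$ and a $q$-cochain $b$ with complex values let $$(a\cup b)(\sigma)=\frac{0!\,q!}{(0+q+1)!}\sum_{v\in\sigma}a(v)\,b(\sigma),$$ the sum being over the vertices of $\sigma$. For $c\in C^q(K,E)$ let $c_{l,s}$ be the components of $c$ in the frame $e_{l,\cdot}$, a cochain on $\overline U_l$, and let $(i_l)_{ps}$ be the entries of the matrix of $i_l$ in this frame. Define $I^Kc=\sum_l I^K_l\Psi^K_lc\in C^q(K,V)$, where the $V_l$-part has components $$(I^K_l\Psi^K_lc)_p=\sum_s R^K\big((i_l)_{ps}\big)\cup\big(R^K(\psi_l)\cup c_{l,s}\big)$$ on $\overline U_l$, extended by zero to the other simplices. Let $\mu_v$ be the barycentric coordinate function of the vertex $v$, and let $W^K$ be the Whitney map, which sends a $V$-valued cochain $b$ to the almost everywhere defined $V$-valued form $\sum_\sigma W^K(\sigma)\otimes b(\sigma)$, where for an oriented simplex $$W^K([v_0,\dots,v_q])=q!\sum_{j=0}^q(-1)^j\mu_{v_j}\,d\mu_{v_0}\wedge\dots\wedge\widehat{d\mu_{v_j}}\wedge\dots\wedge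 d\mu_{v_q}$$ (and $W^K([v_0])=\mu_{v_0}$ for $q=0$). The twisted Whitney map $\widetilde W^K=i^*W^KI^K$ sends twisted cochains in $C^q(K,E)$ to $E$-valued $q$-forms on $M$, forms that agree almost everywhere for the Riemannian volume being identified. **Lemma 4.1.** There is $\delta>0$ (depending on the data above except $K$, its orientations and its reference points) such that for every finite subdivision $K$ of $K_0$ of mesh less than $\delta$ (the mesh being the largest Riemannian diameter of a simplex), every orientation of its simplices, every choice of reference points and every $q\ge 0$: 1. $\widetilde W^K$ is injective on $C^q(K,E)$; 2. for all $c,c'\in C^q(K,E)$ the pointwise Hermitian product of $\widetilde W^Kc$ and $\widetilde W^Kc'$, induced by the metrics of $M$ and $E$, is integrable on $M$, and $\langle c,c'\rangle_W=\int_M\langle\widetilde W^Kc,\widetilde W^Kc'\rangle\,d\mathrm{vol}$ is a (positive definite Hermitian) inner product on $C^q(K,E)$. -/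

import Mathlib

open scoped Manifold ContDiff Nat InnerProductSpace
open MeasureTheory Bundle

noncomputable section

namespace TwistedWhitney

/-! ### Barycentric coordinates in a geometric simplicial complex -/

section Barycentric

variable {A : Type*} [AddCommGroup A] [Module ℝ A]

/-- `w` is a system of barycentric weights of the point `a` of the polyhedron of `K`: nonnegative,
of total mass `1`, carried by the vertices of one simplex of `K`, with barycentre `a`. -/
def IsBarycentric (K : Geometry.SimplicialComplex ℝ A) (a : A) (w : A → ℝ) : Prop :=
  ∃ s ∈ K.faces, (∀ v, 0 ≤ w v) ∧ (∀ v, v ∉ s → w v = 0) ∧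
    ∑ v ∈ s, w v = 1 ∧ ∑ v ∈ s, w v • v = a

/-- Every point of the polyhedron has barycentric weights. -/
theorem exists_isBarycentric (K : Geometry.SimplicialComplex ℝ A) {a : A} (ha : a ∈ K.space) :
    ∃ w, IsBarycentric K a w := by
  classical
  obtain ⟨s, hs, has⟩ := Geometry.SimplicialComplex.mem_space_iff.1 ha
  obtain ⟨w, h0, h1, h2⟩ := Finset.mem_convexHull'.1 has
  refine ⟨fun v => if v ∈ s then w v else 0, s, hs, ?_, ?_, ?_, ?_⟩
  · intro v
    by_cases hv : v ∈ s
    · simpa [hv] using h0 v hv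
    · simp [hv]
  · intro v hv
    simp [hv]
  · rw [← h1]
    exact Finset.sum_congr rfl fun v hv => by simp [hv]
  · rw [← h2]
    exact Finset.sum_congr rfl fun v hv => by simp [hv]

/-- Barycentric weights are unique. -/
theorem IsBarycentric.unique {K : Geometry.SimplicialComplex ℝ A} {a : A} {w w' : A → ℝ}
    (h : IsBarycentric K a w) (h' : IsBarycentric K a w') : w = w' := by
  classical
  obtain ⟨s, hs, p0, pz, p1, p2⟩ := h
  obtain ⟨t, ht, q0, qz, q1, q2⟩ := h'
  have has : a ∈ convexHull ℝ (s : Set A) :=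
    Finset.mem_convexHull'.2 ⟨w, fun v _ => p0 v, p1, p2⟩
  have hat : a ∈ convexHull ℝ (t : Set A) :=
    Finset.mem_convexHull'.2 ⟨w', fun v _ => q0 v, q1, q2⟩
  have hst : a ∈ convexHull ℝ (((s ∩ t : Finset A)) : Set A) := by
    rw [Finset.coe_inter]
    exact K.inter_subset_convexHull hs ht ⟨has, hat⟩
  obtain ⟨u, -, u1, u2⟩ := Finset.mem_convexHull'.1 hst
  set z : A → ℝ := fun v => if v ∈ s ∩ t then u v else 0 with hz
  -- on a face `r` containing `s ∩ t`, weights are determined by affine independence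
  have key : ∀ (r : Finset A), r ∈ K.faces → s ∩ t ⊆ r → ∀ x : A → ℝ, (∀ v, v ∉ r → x v = 0) →
      ∑ v ∈ r, x v = 1 → ∑ v ∈ r, x v • v = a → x = z := by
    intro r hr hsub x xz x1 x2
    have e1 : ∑ v ∈ r, z v = 1 := by
      rw [← u1, hz, Finset.sum_ite_mem, Finset.inter_eq_right.2 hsub]
    have e2 : ∑ v ∈ r, z v • v = a := by
      have : ∀ v, z v • v = if v ∈ s ∩ t then u v • v else 0 := by
        intro v; simp only [hz]; split_ifs <;> simp
      simp only [this]
      rw [Finset.sum_ite_mem, Finset.inter_eq_right.2 hsub, u2]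
    have hind := K.indep hr
    have hx : ∀ v ∈ r, x v = z v := by
      have hli := (affineIndependent_iff (k := ℝ) (p := ((↑) : r → A))).1 hind
      intro v hv
      have := hli Finset.univ (fun i => x i - z i)
        (by
          rw [Finset.sum_sub_distrib, Finset.sum_coe_sort r x, Finset.sum_coe_sort r z, x1, e1,
            sub_self])
        (by
          simp only [sub_smul]
          rw [Finset.sum_sub_distrib, Finset.sum_coe_sort r (fun v => x v • v),
            Finset.sum_coe_sort r (fun v => z v • v), x2, e2, sub_self])
        ⟨v, hv⟩ (Finset.mem_univ _)
      exact sub_eq_zero.1 this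
    funext v
    by_cases hv : v ∈ r
    · exact hx v hv
    · rw [xz v hv]
      have : v ∉ s ∩ t := fun h => hv (hsub h)
      simp only [hz, if_neg this]
  rw [key s hs Finset.inter_subset_left w pz p1 p2, key t ht Finset.inter_subset_right w' qz q1 q2]

open Classical in
/-- The barycentric coordinate of the point `a` with respect to the vertex `v` of `K`. -/
def bary (K : Geometry.SimplicialComplex ℝ A) (v a : A) : ℝ :=
  if h : ∃ w, IsBarycentric K a w then h.choose v else 0

end Barycentric

/-! ### Smooth triangulations and subdivisions -/

/-- A smooth triangulation of the manifold `M` (modelled on `ℝ^N`): a finite simplicial complex in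
a finite dimensional vector space, with a homeomorphism from its polyhedron onto `M` (given by `map`
and its inverse `inv`) that is smooth with injective differential on each closed simplex. Only the
values of `map` on the polyhedron matter; derivatives along a simplex are evaluated only on
directions tangent to the simplex, where they are unambiguous. -/
structure SmoothTriangulation (N : ℕ) (M : Type*) [TopologicalSpace M]
    [ChartedSpace (EuclideanSpace ℝ (Fin N)) M]
    (A : Type*) [NormedAddCommGroup A] [NormedSpace ℝ A] where
  /-- the underlying complex -/
  K : Geometry.SimplicialComplex ℝ A
  finite_faces : K.faces.Finite
  /-- the homeomorphism from the polyhedron to the manifold -/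
  map : A → M
  /-- its inverse -/
  inv : M → A
  inv_mem : ∀ x, inv x ∈ K.space
  map_inv : ∀ x, map (inv x) = x
  inv_map : ∀ a ∈ K.space, inv (map a) = a
  continuousOn_map : ContinuousOn map K.space
  continuous_inv : Continuous inv
  smooth_on_face : ∀ s ∈ K.faces, ContMDiffOn 𝓘(ℝ, A) (𝓡 N) ∞ map (convexHull ℝ (s : Set A))
  immersive_on_face : ∀ s ∈ K.faces, ∀ a ∈ convexHull ℝ (s : Set A),
    ∀ w ∈ vectorSpan ℝ (s : Set A),
      mfderivWithin 𝓘(ℝ, A) (𝓡 N) map (convexHull ℝ (s : Set A)) a w = 0 → w = 0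

namespace SmoothTriangulation

section Top

variable {N : ℕ} {M : Type*} [TopologicalSpace M] [ChartedSpace (EuclideanSpace ℝ (Fin N)) M]
  {A : Type*} [NormedAddCommGroup A] [NormedSpace ℝ A]

/-- The closed subset of the manifold covered by the simplex with vertex set `s`. -/
def cell (T : SmoothTriangulation N M A) (s : Finset A) : Set M :=
  T.map '' convexHull ℝ (s : Set A)

/-- `T` is a subdivision of `T₀`: both complexes have the same polyhedron and the same
homeomorphism to `M`, and each simplex of `T` is contained in a simplex of `T₀`. -/
def IsSubdivision (T T₀ : SmoothTriangulation N M A) : Prop :=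
  T.K.space = T₀.K.space ∧ Set.EqOn T.map T₀.map T₀.K.space ∧
    ∀ s ∈ T.K.faces, ∃ t ∈ T₀.K.faces, convexHull ℝ (s : Set A) ⊆ convexHull ℝ (t : Set A)

/-- The set `C ⊆ M` is (the polyhedron of) a subcomplex of `T`. -/
def IsSubcomplex (T : SmoothTriangulation N M A) (C : Set M) : Prop :=
  ∃ L ⊆ T.K.faces, (∀ s ∈ L, ∀ t ⊆ s, t.Nonempty → t ∈ L) ∧ C = ⋃ s ∈ L, T.cell s

/-- The `q`-simplices of the triangulation. -/
def Simplex (T : SmoothTriangulation N M A) (q : ℕ) : Type _ :=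
  {s : Finset A // s ∈ T.K.faces ∧ s.card = q + 1}

/-- The vertices of the triangulation (i.e. its `0`-simplices). -/
def Vertex (T : SmoothTriangulation N M A) : Type _ :=
  {v : A // v ∈ T.K.vertices}

instance (T : SmoothTriangulation N M A) (q : ℕ) : Fintype (T.Simplex q) :=
  have : Finite (T.Simplex q) := (T.finite_faces.subset (fun _ h => h.1)).to_subtype
  Fintype.ofFinite _

instance (T : SmoothTriangulation N M A) : Fintype T.Vertex :=
  have : Finite T.Vertex :=
    (T.finite_faces.preimage (f := fun v : A => ({v} : Finset A))
      (Finset.singleton_injective.injOn)).to_subtype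
  Fintype.ofFinite _

/-- The barycentric coordinate function `μ_v : M → ℝ`. -/
def mu (T : SmoothTriangulation N M A) (v : A) (x : M) : ℝ := bary T.K v (T.inv x)

/-- An orientation of each simplex, given by an ordering of its vertices, and a reference point in
the interior of each simplex. -/
structure Marking (T : SmoothTriangulation N M A) where
  order : ∀ {q : ℕ} (σ : T.Simplex q), Fin (q + 1) ≃ {v : A // v ∈ σ.1}
  refPoint : ∀ {q : ℕ}, T.Simplex q → M
  refPoint_mem : ∀ {q : ℕ} (σ : T.Simplex q),
    refPoint σ ∈ T.map '' intrinsicInterior ℝ (convexHull ℝ (σ.1 : Set A))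

open Classical in
/-- The cup product of a `0`-cochain and a `q`-cochain: the vertex `v` and the `q`-simplex `σ` span
a `q`-simplex and meet in exactly one vertex iff `v` is a vertex of `σ`, and then
`v ∪ σ = (0! q! / (0 + q + 1)!) σ`, the orientations being compatible. -/
def cupZero (T : SmoothTriangulation N M A) {q : ℕ} (a : T.Vertex → ℂ) (c : T.Simplex q → ℂ) :
    T.Simplex q → ℂ := fun σ =>
  ∑ v : T.Vertex, if v.1 ∈ σ.1 then ((0 ! * q ! : ℂ) / ((0 + q + 1) ! : ℂ)) * a v * c σ else 0

/-- The de Rham map on functions: evaluation at the vertices. -/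
def deRhamZero (T : SmoothTriangulation N M A) (g : M → ℂ) : T.Vertex → ℂ := fun v => g (T.map v.1)

end Top

/-- The mesh of a triangulation: the supremum of the diameters of its simplices. -/
def mesh {N : ℕ} {M : Type*} [EMetricSpace M] [ChartedSpace (EuclideanSpace ℝ (Fin N)) M]
    {A : Type*} [NormedAddCommGroup A] [NormedSpace ℝ A] (T : SmoothTriangulation N M A) : ENNReal :=
  ⨆ s ∈ T.K.faces, Metric.ediam (T.cell s)

end SmoothTriangulation

/-! ### The Whitney map -/

/-- The wedge product `α₁ ∧ ⋯ ∧ α_q` of linear forms: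
`(α₁ ∧ ⋯ ∧ α_q)(w₁, …, w_q) = det (α_j (w_i))`. -/
def wedge {q : ℕ} {W : Type*} [AddCommGroup W] [Module ℝ W] (α : Fin q → W →ₗ[ℝ] ℝ) :
    W [⋀^Fin q]→ₗ[ℝ] ℝ :=
  (Matrix.detRowAlternating (n := Fin q) (R := ℝ)).compLinearMap (LinearMap.pi α)

section Whitney

variable {N : ℕ} {M : Type*} [TopologicalSpace M] [ChartedSpace (EuclideanSpace ℝ (Fin N)) M]
  {A : Type*} [NormedAddCommGroup A] [NormedSpace ℝ A]

/-- The differential `dμ_v` at `x`. (Barycentric coordinates are smooth off the `(N-1)`-skeleton, a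
null set; on it the value is immaterial.) -/
def dmu (T : SmoothTriangulation N M A) (v : A) (x : M) : TangentSpace (𝓡 N) x →ₗ[ℝ] ℝ :=
  let d : TangentSpace (𝓡 N) x →L[ℝ] ℝ := mfderiv (𝓡 N) 𝓘(ℝ, ℝ) (T.mu v) x
  d.toLinearMap

/-- The Whitney form at `x` of the oriented simplex `[v₀, …, v_q]`:
`q! ∑ᵢ (-1)ⁱ μᵢ dμ₀ ∧ ⋯ ∧ (omit dμᵢ) ∧ ⋯ ∧ dμ_q`, which is `μ₀` when `q = 0`. -/
def whitneyForm (T : SmoothTriangulation N M A) {q : ℕ} (v : Fin (q + 1) → A) (x : M) :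
    TangentSpace (𝓡 N) x [⋀^Fin q]→ₗ[ℝ] ℝ :=
  (q ! : ℝ) • ∑ i : Fin (q + 1),
    ((-1) ^ (i : ℕ) * T.mu (v i) x) • wedge (fun j : Fin q => dmu T (v (i.succAbove j)) x)

/-- The Whitney map on cochains with values in the complex vector space `V`:
`W c = ∑_σ W(σ) ⊗ c(σ)`, at the point `x`. -/
def whitneyMap (T : SmoothTriangulation N M A) (m : T.Marking) {q : ℕ}
    {V : Type*} [AddCommGroup V] [Module ℝ V] (c : T.Simplex q → V) (x : M) :
    TangentSpace (𝓡 N) x [⋀^Fin q]→ₗ[ℝ] V :=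
  ∑ σ : T.Simplex q, (LinearMap.toSpanSingleton ℝ V (c σ)).compAlternatingMap
    (whitneyForm T (fun i => (m.order σ i : A)) x)

end Whitney

/-! ### The Riemannian volume measure and the `L²` pairing of forms -/

section Riemannian

variable {N : ℕ} {M : Type*} [TopologicalSpace M] [ChartedSpace (EuclideanSpace ℝ (Fin N)) M]

/-- The coordinate vector field `∂ᵢ` of the chart at `x₀`, at the point with coordinates `z`. -/
def coordVector (x₀ : M) (z : EuclideanSpace ℝ (Fin N)) (i : Fin N) :
    TangentSpace (𝓡 N) ((chartAt (EuclideanSpace ℝ (Fin N)) x₀).symm z) :=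
  mfderiv 𝓘(ℝ, EuclideanSpace ℝ (Fin N)) (𝓡 N) (chartAt (EuclideanSpace ℝ (Fin N)) x₀).symm z
    (EuclideanSpace.single i (1 : ℝ))

variable [RiemannianBundle (fun x : M => TangentSpace (𝓡 N) x)]

/-- The Riemannian volume density `√det(g_ij)` in the chart at `x₀`. -/
def volumeDensity (x₀ : M) (z : EuclideanSpace ℝ (Fin N)) : ℝ :=
  Real.sqrt (Matrix.det (Matrix.of fun i j : Fin N =>
    (inner ℝ (coordVector x₀ z i) (coordVector x₀ z j) : ℝ)))

variable [MeasurableSpace M]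

/-- The measure `√det(g_ij) dz₁ ⋯ dz_N` on the domain of the chart at `x₀`. -/
def chartVolume (x₀ : M) : Measure M :=
  ((volume.restrict (chartAt (EuclideanSpace ℝ (Fin N)) x₀).target).withDensity
    (fun z => ENNReal.ofReal (volumeDensity (N := N) x₀ z))).map
      (chartAt (EuclideanSpace ℝ (Fin N)) x₀).symm

variable (N M) in
/-- The volume measure of the Riemannian metric, glued from the volume measures of the charts by
a smooth partition of unity (the result does not depend on the partition of unity). -/
def riemannianVolume [T2Space M] [SigmaCompactSpace M] [IsManifold (𝓡 N) ∞ M] : Measure M :=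
  Measure.sum fun x₀ : M => (chartVolume (N := N) x₀).withDensity fun x =>
    ENNReal.ofReal
      ((SmoothPartitionOfUnity.exists_isSubordinate_chartAt_source (𝓡 N) M).choose x₀ x)

/-- The Hermitian inner product (conjugate linear in the first variable) induced on
`Λ^q T_x^*M ⊗ V` by the Riemannian metric and the Hermitian space `V`:
`⟨α, β⟩ = ∑_{i₁ < ⋯ < i_q} ⟨α(e_{i₁}, …, e_{i_q}), β(e_{i₁}, …, e_{i_q})⟩` for an orthonormal
basis `e` of `T_xM` (the value does not depend on `e`). -/
def formInner {q : ℕ} {V : Type*} [NormedAddCommGroup V] [InnerProductSpace ℂ V] (x : M)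
    (α β : TangentSpace (𝓡 N) x [⋀^Fin q]→ₗ[ℝ] V) : ℂ :=
  have : FiniteDimensional ℝ (TangentSpace (𝓡 N) x) :=
    inferInstanceAs (FiniteDimensional ℝ (EuclideanSpace ℝ (Fin N)))
  ∑ J : Fin q ↪o Fin (Module.finrank ℝ (TangentSpace (𝓡 N) x)),
    inner ℂ (α fun k => stdOrthonormalBasis ℝ (TangentSpace (𝓡 N) x) (J k))
      (β fun k => stdOrthonormalBasis ℝ (TangentSpace (𝓡 N) x) (J k))

end Riemannian

/-! ### The bundle `E` and its embedding into a trivial bundle -/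

section Embedding

variable {N : ℕ} {M : Type*} [TopologicalSpace M] [ChartedSpace (EuclideanSpace ℝ (Fin N)) M]
  {A : Type*} [NormedAddCommGroup A] [NormedSpace ℝ A]

/-- A smooth Hermitian metric: the inner product of the fibres depends smoothly on the base
point, as seen in the local trivializations of the bundle. -/
class IsSmoothHermitian (N : ℕ) {M : Type*} [TopologicalSpace M]
    [ChartedSpace (EuclideanSpace ℝ (Fin N)) M]
    (F : Type*) [NormedAddCommGroup F] [NormedSpace ℂ F]
    (E : M → Type*) [TopologicalSpace (TotalSpace F E)]
    [∀ x, NormedAddCommGroup (E x)] [∀ x, InnerProductSpace ℂ (E x)] [FiberBundle F E] : Prop where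
  smooth_inner : ∀ (x₀ : M) (u v : F), ContMDiffOn (𝓡 N) 𝓘(ℝ, ℂ) ∞
    (fun x => (inner ℂ ((trivializationAt F E x₀).symm x u) ((trivializationAt F E x₀).symm x v) : ℂ))
    (trivializationAt F E x₀).baseSet

/-- The data from which the isometric embedding `i = ∑_l ψ_l i_l` of the Hermitian bundle `E` into a
trivial Hermitian bundle `V = ⨁_l V_l` is built: a finite open cover `U_l` of `M` whose members
have closures that are subcomplexes of `T₀`; smooth frames of `E` over the closures of the `U_l`;
smooth isometric embeddings `i_l` of `E` over the closure of `U_l` into a trivial Hermitian bundle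
`V_l` with fibre `ℂ^(n_l)`; and smooth functions `ψ_l ≥ 0` with support in `U_l` and
`∑_l ψ_l² = 1`. Values of `frame l` and `emb l` off the closure of `U_l` are never used. -/
structure EmbeddingData (T₀ : SmoothTriangulation N M A)
    (F : Type*) [NormedAddCommGroup F] [NormedSpace ℂ F]
    (E : M → Type*) [TopologicalSpace (TotalSpace F E)]
    [∀ x, NormedAddCommGroup (E x)] [∀ x, InnerProductSpace ℂ (E x)] [FiberBundle F E]
    (ι : Type*) [Fintype ι] where
  U : ι → Set M
  isOpen_U : ∀ l, IsOpen (U l)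
  cover : ⋃ l, U l = Set.univ
  subcomplex : ∀ l, T₀.IsSubcomplex (closure (U l))
  ψ : ι → M → ℝ
  ψ_smooth : ∀ l, ContMDiff (𝓡 N) 𝓘(ℝ, ℝ) ∞ (ψ l)
  ψ_nonneg : ∀ l x, 0 ≤ ψ l x
  ψ_support : ∀ l, tsupport (ψ l) ⊆ U l
  ψ_sq_sum : ∀ x, ∑ l, ψ l x ^ 2 = 1
  frame : ι → ∀ x, Module.Basis (Fin (Module.finrank ℂ F)) ℂ (E x)
  frame_smooth : ∀ l s, ContMDiffOn (𝓡 N) ((𝓡 N).prod 𝓘(ℝ, F)) ∞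
    (fun x => (⟨x, frame l x s⟩ : TotalSpace F E)) (closure (U l))
  n : ι → ℕ
  emb : ∀ l x, E x →ₗ[ℂ] EuclideanSpace ℂ (Fin (n l))
  emb_isometry : ∀ l, ∀ x ∈ closure (U l), ∀ u, ‖emb l x u‖ = ‖u‖
  emb_smooth : ∀ l s, ContMDiffOn (𝓡 N) 𝓘(ℝ, EuclideanSpace ℂ (Fin (n l))) ∞
    (fun x => emb l x (frame l x s)) (closure (U l))

namespace EmbeddingData

variable {F : Type*} [NormedAddCommGroup F] [NormedSpace ℂ F]
  {E : M → Type*} [TopologicalSpace (TotalSpace F E)]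
  [∀ x, NormedAddCommGroup (E x)] [∀ x, InnerProductSpace ℂ (E x)] [FiberBundle F E]
  {ι : Type*} [Fintype ι] {T₀ : SmoothTriangulation N M A}

/-- The fibre of the trivial Hermitian bundle `V = ⨁_l V_l` (orthogonal direct sum). -/
abbrev V (D : EmbeddingData T₀ F E ι) : Type _ :=
  PiLp 2 fun l : ι => EuclideanSpace ℂ (Fin (D.n l))

/-- The embedding `i = ∑_l ψ_l i_l : E → V` on the fibre over `x`. -/
def i (D : EmbeddingData T₀ F E ι) (x : M) : E x →ₗ[ℂ] D.V where
  toFun u := WithLp.toLp 2 fun l => (D.ψ l x : ℂ) • D.emb l x u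
  map_add' u v := by
    ext l p
    simp
  map_smul' a u := by
    ext l p
    simp [mul_left_comm]

/-- The entry `(i_l)_{ps}` of the matrix of `i_l` with respect to the frame of `E` over `U_l`. -/
def entry (D : EmbeddingData T₀ F E ι) (l : ι) (p : Fin (D.n l))
    (s : Fin (Module.finrank ℂ F)) (x : M) : ℂ :=
  D.emb l x (D.frame l x s) p

end EmbeddingData

end Embedding

/-! ### Twisted cochains and the twisted Whitney map -/

section Twisted

variable {N : ℕ} {M : Type*} [TopologicalSpace M] [ChartedSpace (EuclideanSpace ℝ (Fin N)) M]
  {A : Type*} [NormedAddCommGroup A] [NormedSpace ℝ A]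
  {T : SmoothTriangulation N M A}

/-- The twisted `q`-cochains `C^q(K, E)`: to each `q`-simplex a vector in the fibre of `E` over the
reference point of the simplex. -/
abbrev TwistedCochain (m : T.Marking) (E : M → Type*) (q : ℕ) : Type _ :=
  ∀ σ : T.Simplex q, E (m.refPoint σ)

variable {F : Type*} [NormedAddCommGroup F] [NormedSpace ℂ F]
  {E : M → Type*} [TopologicalSpace (TotalSpace F E)]
  [∀ x, NormedAddCommGroup (E x)] [∀ x, InnerProductSpace ℂ (E x)] [FiberBundle F E]
  {ι : Type*} [Fintype ι] {T₀ : SmoothTriangulation N M A}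

/-- The components `c_s` of a twisted cochain in the frame of `E` over `U_l`. -/
def component (D : EmbeddingData T₀ F E ι) {m : T.Marking} {q : ℕ} (c : TwistedCochain m E q)
    (l : ι) (s : Fin (Module.finrank ℂ F)) : T.Simplex q → ℂ :=
  fun σ => (D.frame l (m.refPoint σ)).repr (c σ) s

/-- `(I_l Ψ_l c)_p = ∑_s R((i_l)_{ps}) ∪ (R(ψ_l) ∪ c_s)`. -/
def localI (D : EmbeddingData T₀ F E ι) {m : T.Marking} {q : ℕ} (c : TwistedCochain m E q)
    (l : ι) (p : Fin (D.n l)) : T.Simplex q → ℂ :=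
  ∑ s, T.cupZero (T.deRhamZero (D.entry l p s))
    (T.cupZero (T.deRhamZero fun x => (D.ψ l x : ℂ)) (component D c l s))

open Classical in
/-- `I c = ∑_l I_l Ψ_l c`, a cochain with values in `V = ⨁_l V_l`. The `l`-th summand is a
cochain on the subcomplex `closure U_l`, extended by zero to the other simplices. -/
def twistI (D : EmbeddingData T₀ F E ι) {m : T.Marking} {q : ℕ} (c : TwistedCochain m E q) :
    T.Simplex q → D.V := fun σ =>
  WithLp.toLp 2 fun l => WithLp.toLp 2 fun p =>
    if T.cell σ.1 ⊆ closure (D.U l) then localI D c l p σ else 0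

/-- The twisted Whitney map `i^* W I`, where `i^*` is the fibrewise adjoint of `i`: the value at the
point `x` of the `E`-valued `q`-form assigned to the twisted cochain `c`. -/
def twistedWhitney [∀ x, FiniteDimensional ℂ (E x)] (D : EmbeddingData T₀ F E ι) {m : T.Marking}
    {q : ℕ} (c : TwistedCochain m E q) (x : M) : TangentSpace (𝓡 N) x [⋀^Fin q]→ₗ[ℝ] E x :=
  ((LinearMap.adjoint (D.i x)).restrictScalars ℝ).compAlternatingMap
    (whitneyMap T m (twistI D c) x)

end Twisted

end TwistedWhitney

end

/-!
The Whitney forms have a duality property: on the edge vectors of a `q`-simplex `σ` spanned at a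
point of `σ`, the Whitney form of `σ` takes the value `q!` times the sum of the barycentric
coordinates of the vertices of `σ`, that is `q!`, and those of the other `q`-simplices vanish.
In the affine parametrization of a top-dimensional cell by the standard simplex, Whitney forms have
coefficients affine in the parameter (`whitneyMap_cellMap`), so they can be evaluated at points of
the open cell tending to a boundary point (`whitneyCoord_edges`). Hence, if `i^* W I c` vanishes
almost everywhere, letting points of an open top-dimensional cell tend to the reference point `p_σ`
of a face `σ` gives `i^*(p_σ) ((I c) σ) = 0` (`adjoint_apply_eq_zero_of_dense`; null sets have dense
complement, and every simplex lies in a top-dimensional one).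

By the definition of the cup product with a function, `(I c) σ` is obtained from `c σ` by the matrix
of `i` in the frames, except that `ψ_l` and the matrix entries of `i_l` are replaced by their means
over the vertices of `σ` (`twistI_apply`). By uniform continuity on compact sets this is so close to
`i (c σ)` when `σ` is small that `i^*(p_σ) ((I c) σ) = 0` forces `c σ = 0`
(`EmbeddingData.exists_delta_meanEmbedding`). A small simplex meeting the support of `ψ_l` lies in
`U_l`, so the extension by zero of the cochains on the closure of `U_l` does no harm. This gives
injectivity, and with it the definiteness of the pairing.

For integrability, the union of the open top-dimensional cells has full measure
(`ae_mem_image_openCorner`: the lower-dimensional cells are smooth images of sets in hyperplanes).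
On each of them the pointwise product is a polynomial in the coefficients of the forms, the inverse
Gram matrix of the coordinate fields (`formInner_cellMap`) and the products
`⟨i^* v, i^* v'⟩`, all of which extend continuously to the compact parameter domain of the closed
cell; the last ones do because `i i^*` is a continuous family of projections
(`EmbeddingData.continuous_inner_adjoint_i`). So it is bounded, and the volume of `M` is finite
(`isFiniteMeasure_riemannianVolume`).
-/

open scoped Manifold ContDiff Nat InnerProductSpace
open MeasureTheory Bundle

noncomputable section

namespace TwistedWhitney

/-! ### The inner product of alternating forms -/

/-- The sum over all multi-indices of a symmetric function vanishing on multi-indices with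
repetitions is `q!` times its sum over the increasing ones. -/
theorem sum_eq_factorial_nsmul_sum_orderEmbedding {q n : ℕ} {R : Type*} [AddCommMonoid R]
    (g : (Fin q → Fin n) → R) (hperm : ∀ J (ρ : Equiv.Perm (Fin q)), g (J ∘ ρ) = g J)
    (hinj : ∀ J, ¬ Function.Injective J → g J = 0) :
    ∑ J, g J = q ! • ∑ J : Fin q ↪o Fin n, g J := by
  classical
  have h1 : ∑ J, g J = ∑ J ∈ Finset.univ.filter (fun J : Fin q → Fin n => Function.Injective J),
      g J := by
    rw [Finset.sum_filter]
    exact Finset.sum_congr rfl fun J _ => by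
      split_ifs with h
      · rfl
      · exact hinj J h
  have h2 : ∑ p : (Fin q ↪o Fin n) × Equiv.Perm (Fin q), g (p.1 ∘ p.2) =
      ∑ J ∈ Finset.univ.filter (fun J : Fin q → Fin n => Function.Injective J), g J := by
    refine Finset.sum_bij (fun p _ => p.1 ∘ p.2) ?_ ?_ ?_ (fun _ _ => rfl)
    · intro p _
      simpa using p.1.injective
    · rintro ⟨J, ρ⟩ _ ⟨J', ρ'⟩ _ h
      have hr : Set.range J = Set.range J' := by
        have := congrArg Set.range h
        simpa [Set.range_comp] using this
      obtain rfl : J = J' := OrderEmbedding.range_inj.1 hr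
      have : ρ = ρ' := Equiv.ext fun k => J.injective (congrFun h k)
      rw [this]
    · intro J hJ
      have hJ' : Function.Injective J := by simpa using hJ
      have hm : StrictMono (J ∘ Tuple.sort J) :=
        (Tuple.monotone_sort J).strictMono_of_injective (hJ'.comp (Tuple.sort J).injective)
      refine ⟨(OrderEmbedding.ofStrictMono _ hm, (Tuple.sort J)⁻¹), Finset.mem_univ _, ?_⟩
      funext k
      simp
  rw [h1, ← h2, Fintype.sum_prod_type, Finset.smul_sum]
  refine Finset.sum_congr rfl fun J _ => ?_
  simp [hperm, Fintype.card_perm]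

section Gram

variable {V : Type*} [NormedAddCommGroup V] [InnerProductSpace ℂ V]
  {W : Type*} [NormedAddCommGroup W] [InnerProductSpace ℝ W]

/-- If `a` expresses an orthonormal basis `e` in a basis `f`, then `a aᵀ` is the inverse of the
Gram matrix of `f`. -/
theorem sum_repr_mul_repr_eq_gram_inv {ι κ : Type*} [Fintype ι] [DecidableEq ι] [Fintype κ]
    (e : OrthonormalBasis κ ℝ W) (f : Module.Basis ι ℝ W) (i i' : ι) :
    ∑ j, f.repr (e j) i * f.repr (e j) i' = (Matrix.gram ℝ f)⁻¹ i i' := by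
  have key : (Matrix.of fun i i' => ∑ j, f.repr (e j) i * f.repr (e j) i') * Matrix.gram ℝ f
      = 1 := by
    ext i k
    have h1 : ∀ j, ∑ i', f.repr (e j) i' * inner ℝ (f i') (f k) = inner ℝ (e j) (f k) := by
      intro j
      conv_rhs => rw [← f.sum_repr (e j), sum_inner]
      simp [inner_smul_left]
    calc _ = ∑ i', (∑ j, f.repr (e j) i * f.repr (e j) i') * inner ℝ (f i') (f k) := by
            simp [Matrix.mul_apply, Matrix.gram_apply]
      _ = ∑ j, f.repr (e j) i * inner ℝ (e j) (f k) := by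
            simp_rw [Finset.sum_mul]
            rw [Finset.sum_comm]
            refine Finset.sum_congr rfl fun j _ => ?_
            rw [← h1, Finset.mul_sum]
            exact Finset.sum_congr rfl fun i' _ => by ring
      _ = f.repr (∑ j, inner ℝ (e j) (f k) • e j) i := by
            simp [mul_comm]
      _ = (1 : Matrix ι ι ℝ) i k := by
            rw [e.sum_repr' (f k), f.repr_self, Finsupp.single_apply, Matrix.one_apply]
            simp [eq_comm]
  rw [Matrix.inv_eq_left_inv key]
  rfl

/-- The induced inner product of alternating forms, computed in an arbitrary basis. -/
theorem sum_inner_apply_orthonormalBasis {q : ℕ} {ι κ : Type*} [Fintype ι] [DecidableEq ι]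
    [Fintype κ] [DecidableEq κ] (e : OrthonormalBasis κ ℝ W) (f : Module.Basis ι ℝ W)
    (α β : W [⋀^Fin q]→ₗ[ℝ] V) :
    ∑ J : Fin q → κ, inner ℂ (α fun k => e (J k)) (β fun k => e (J k)) =
      ∑ I : Fin q → ι, ∑ I' : Fin q → ι,
        ((∏ k, (Matrix.gram ℝ f)⁻¹ (I k) (I' k) : ℝ) : ℂ) *
          inner ℂ (α fun k => f (I k)) (β fun k => f (I' k)) := by
  have expand : ∀ (γ : W [⋀^Fin q]→ₗ[ℝ] V) (J : Fin q → κ), γ (fun k => e (J k)) =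
      ∑ I : Fin q → ι, (∏ k, f.repr (e (J k)) (I k)) • γ fun k => f (I k) := by
    intro γ J
    have h := γ.toMultilinearMap.map_sum (fun k i => f.repr (e (J k)) i • f i)
    simp only [AlternatingMap.coe_multilinearMap, f.sum_repr] at h
    rw [h]
    exact Finset.sum_congr rfl fun I _ => γ.toMultilinearMap.map_smul_univ _ _
  have hprod : ∀ I I' : Fin q → ι, ∏ k, (Matrix.gram ℝ f)⁻¹ (I k) (I' k) =
      ∑ J : Fin q → κ, ∏ k, (f.repr (e (J k)) (I k) * f.repr (e (J k)) (I' k)) := by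
    intro I I'
    simp_rw [← sum_repr_mul_repr_eq_gram_inv e f]
    rw [Finset.prod_univ_sum]
    simp
  simp_rw [hprod, expand, sum_inner, inner_sum, Complex.ofReal_sum, Finset.sum_mul]
  rw [Finset.sum_comm]
  refine Finset.sum_congr rfl fun I _ => ?_
  rw [Finset.sum_comm]
  refine Finset.sum_congr rfl fun I' _ => ?_
  refine Finset.sum_congr rfl fun J _ => ?_
  rw [RCLike.real_smul_eq_coe_smul (K := ℂ), RCLike.real_smul_eq_coe_smul (K := ℂ),
    inner_smul_left, inner_smul_right, Finset.prod_mul_distrib]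
  simp [mul_assoc]

end Gram

section FormInner

variable {N : ℕ} {M : Type*} [TopologicalSpace M] [ChartedSpace (EuclideanSpace ℝ (Fin N)) M]
  [RiemannianBundle (fun x : M => TangentSpace (𝓡 N) x)]
  {V : Type*} [NormedAddCommGroup V] [InnerProductSpace ℂ V] {q : ℕ} {x : M}

instance finiteDimensional_tangentSpace (x : M) :
    FiniteDimensional ℝ (TangentSpace (𝓡 N) x) :=
  inferInstanceAs (FiniteDimensional ℝ (EuclideanSpace ℝ (Fin N)))

/-- The sum over increasing multi-indices defining `formInner`, as a sum over all multi-indices. -/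
theorem factorial_mul_formInner (α β : TangentSpace (𝓡 N) x [⋀^Fin q]→ₗ[ℝ] V) :
    (q ! : ℂ) * formInner x α β =
      ∑ J : Fin q → Fin (Module.finrank ℝ (TangentSpace (𝓡 N) x)),
        inner ℂ (α fun k => stdOrthonormalBasis ℝ (TangentSpace (𝓡 N) x) (J k))
          (β fun k => stdOrthonormalBasis ℝ (TangentSpace (𝓡 N) x) (J k)) := by
  rw [sum_eq_factorial_nsmul_sum_orderEmbedding, nsmul_eq_mul]
  · rfl
  · intro J ρ
    have hα := α.map_perm (fun k => stdOrthonormalBasis ℝ (TangentSpace (𝓡 N) x) (J k)) ρ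
    have hβ := β.map_perm (fun k => stdOrthonormalBasis ℝ (TangentSpace (𝓡 N) x) (J k)) ρ
    simp only [Function.comp_def] at hα hβ ⊢
    rw [hα, hβ]
    rcases Int.units_eq_one_or (Equiv.Perm.sign ρ) with h | h <;> simp [h]
  · intro J hJ
    simp only [Function.Injective, not_forall] at hJ
    obtain ⟨a, b, hab, hne⟩ := hJ
    rw [α.map_eq_zero_of_eq _ (by simp only [hab]) hne, inner_zero_left]

/-- `formInner` computed in an arbitrary basis of the tangent space. -/
theorem formInner_eq_of_basis {ι : Type*} [Fintype ι] [DecidableEq ι]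
    (f : Module.Basis ι ℝ (TangentSpace (𝓡 N) x))
    (α β : TangentSpace (𝓡 N) x [⋀^Fin q]→ₗ[ℝ] V) :
    formInner x α β = (q ! : ℂ)⁻¹ * ∑ I : Fin q → ι, ∑ I' : Fin q → ι,
        ((∏ k, (Matrix.gram ℝ f)⁻¹ (I k) (I' k) : ℝ) : ℂ) *
          inner ℂ (α fun k => f (I k)) (β fun k => f (I' k)) := by
  rw [eq_inv_mul_iff_mul_eq₀ (by exact_mod_cast q.factorial_ne_zero), factorial_mul_formInner,
    sum_inner_apply_orthonormalBasis (stdOrthonormalBasis ℝ (TangentSpace (𝓡 N) x)) f]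

theorem formInner_add_left (α α' β : TangentSpace (𝓡 N) x [⋀^Fin q]→ₗ[ℝ] V) :
    formInner x (α + α') β = formInner x α β + formInner x α' β := by
  simp [formInner, Finset.sum_add_distrib]

theorem formInner_smul_left (a : ℂ) (α β : TangentSpace (𝓡 N) x [⋀^Fin q]→ₗ[ℝ] V) :
    formInner x (a • α) β = star a * formInner x α β := by
  simp [formInner, Finset.mul_sum, mul_comm]

theorem star_formInner (α β : TangentSpace (𝓡 N) x [⋀^Fin q]→ₗ[ℝ] V) :
    star (formInner x β α) = formInner x α β := by
  simp [formInner]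

/-- `formInner` is positive definite. -/
theorem formInner_self_eq (α : TangentSpace (𝓡 N) x [⋀^Fin q]→ₗ[ℝ] V) :
    ∃ r : ℝ, 0 ≤ r ∧ formInner x α α = r ∧ (r = 0 → α = 0) := by
  refine ⟨(formInner x α α).re, ?_, ?_, ?_⟩
  · simp only [formInner, Complex.re_sum]
    exact Finset.sum_nonneg fun J _ => inner_self_nonneg (𝕜 := ℂ)
  · exact (Complex.conj_eq_iff_re.1 (star_formInner α α)).symm
  · intro h
    have h' : formInner x α α = 0 := by
      rw [← (Complex.conj_eq_iff_re.1 (star_formInner α α)), h, Complex.ofReal_zero]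
    have h2 := factorial_mul_formInner α α
    rw [h', mul_zero] at h2
    have h3 := congrArg Complex.re h2.symm
    rw [Complex.re_sum, Complex.zero_re] at h3
    replace h3 := (Finset.sum_eq_zero_iff_of_nonneg
      (fun J _ => inner_self_nonneg (𝕜 := ℂ))).1 h3
    refine Module.Basis.ext_alternating (stdOrthonormalBasis ℝ (TangentSpace (𝓡 N) x)).toBasis
      fun J _ => ?_
    have := h3 J (Finset.mem_univ _)
    simpa using (inner_self_eq_zero (𝕜 := ℂ)).1
      (Complex.ext this (inner_self_im (𝕜 := ℂ) _))

end FormInner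

/-! ### Continuity of the embedding and of its adjoint -/

/-- Inversion of continuous linear maps is continuous at the invertible ones, along any family. -/
theorem continuousWithinAt_inverse_clm {X E₁ E₂ : Type*} [TopologicalSpace X]
    [NormedAddCommGroup E₁] [NormedSpace ℂ E₁] [CompleteSpace E₁]
    [NormedAddCommGroup E₂] [NormedSpace ℂ E₂] {Φ : X → E₁ →L[ℂ] E₂} {s : Set X} {x : X}
    (hΦ : ContinuousWithinAt Φ s x) (g : E₁ ≃L[ℂ] E₂) (hg : Φ x = g) :
    ContinuousWithinAt (fun y => ContinuousLinearMap.inverse (Φ y)) s x := by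
  have h : ContinuousAt (ContinuousLinearMap.inverse : (E₁ →L[ℂ] E₂) → E₂ →L[ℂ] E₁) (Φ x) := by
    rw [hg]
    exact (contDiffAt_map_inverse (𝕜 := ℂ) (n := 0) g).continuousAt
  exact h.comp_continuousWithinAt hΦ

section Embedding

variable {N : ℕ} {M : Type*} [TopologicalSpace M] [ChartedSpace (EuclideanSpace ℝ (Fin N)) M]
  {F : Type*} [NormedAddCommGroup F] [NormedSpace ℂ F]
  {E : M → Type*} [TopologicalSpace (TotalSpace F E)]
  [∀ x, NormedAddCommGroup (E x)] [∀ x, InnerProductSpace ℂ (E x)]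
  [FiberBundle F E]
  {A : Type*} [NormedAddCommGroup A] [NormedSpace ℝ A]
  {T₀ : SmoothTriangulation N M A} {ι : Type*} [Fintype ι] (D : EmbeddingData T₀ F E ι)

namespace EmbeddingData

theorem ψ_le_one (l : ι) (x : M) : D.ψ l x ≤ 1 := by
  have h : D.ψ l x ^ 2 ≤ 1 := by
    rw [← D.ψ_sq_sum x]
    exact Finset.single_le_sum (f := fun l => D.ψ l x ^ 2) (fun _ _ => sq_nonneg _)
      (Finset.mem_univ l)
  exact (sq_le_one_iff₀ (D.ψ_nonneg l x)).1 h

theorem mem_U_of_ψ_ne_zero {l : ι} {x : M} (h : D.ψ l x ≠ 0) : x ∈ D.U l :=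
  D.ψ_support l (subset_tsupport _ h)

/-- The embedding `i` is isometric, because `∑ ψ_l² = 1` and each `i_l` is isometric where
`ψ_l ≠ 0`. -/
theorem norm_i (x : M) (u : E x) : ‖D.i x u‖ = ‖u‖ := by
  have h : ‖D.i x u‖ ^ 2 = ‖u‖ ^ 2 := by
    rw [PiLp.norm_sq_eq_of_L2]
    calc _ = ∑ l, D.ψ l x ^ 2 * ‖u‖ ^ 2 := by
          refine Finset.sum_congr rfl fun l _ => ?_
          change ‖(D.ψ l x : ℂ) • D.emb l x u‖ ^ 2 = _
          rw [norm_smul, mul_pow, Complex.norm_real, Real.norm_eq_abs, sq_abs]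
          by_cases h0 : D.ψ l x = 0
          · simp [h0]
          · rw [D.emb_isometry l x (subset_closure (D.mem_U_of_ψ_ne_zero h0))]
      _ = ‖u‖ ^ 2 := by rw [← Finset.sum_mul, D.ψ_sq_sum, one_mul]
  exact (sq_eq_sq₀ (norm_nonneg _) (norm_nonneg _)).1 h

theorem inner_i (x : M) (u v : E x) : inner ℂ (D.i x u) (D.i x v) = (inner ℂ u v : ℂ) :=
  (⟨D.i x, D.norm_i x⟩ : E x →ₗᵢ[ℂ] D.V).inner_map_map u v

theorem continuousOn_emb_frame (l : ι) (s : Fin (Module.finrank ℂ F)) :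
    ContinuousOn (fun x => D.emb l x (D.frame l x s)) (closure (D.U l)) :=
  (D.emb_smooth l s).continuousOn

variable [VectorBundle ℂ F E]

/-- `i_l` is continuous on sections that are constant in a local trivialization: their components in
the `l`-th frame are obtained by inverting the matrix of the frame in the trivialization. -/
theorem continuousOn_emb_symm (p : M) (f : F) (l : ι) :
    ContinuousOn (fun x => D.emb l x ((trivializationAt F E p).symm x f))
      (closure (D.U l) ∩ (trivializationAt F E p).baseSet) := by
  set e := trivializationAt F E p with he
  set Φ : M → (Fin (Module.finrank ℂ F) → ℂ) →L[ℂ] F := fun x =>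
    ∑ s, (ContinuousLinearMap.proj s : (Fin (Module.finrank ℂ F) → ℂ) →L[ℂ] ℂ).smulRight
      (e ⟨x, D.frame l x s⟩).2 with hΦ
  have hΦc : ContinuousOn Φ (closure (D.U l) ∩ e.baseSet) := by
    refine continuousOn_finsetSum _ fun s _ => ?_
    have h1 : ContinuousOn (fun x => (⟨x, D.frame l x s⟩ : TotalSpace F E))
        (closure (D.U l) ∩ e.baseSet) :=
      ((D.frame_smooth l s).continuousOn).mono Set.inter_subset_left
    have h2 : ContinuousOn (fun x => (e ⟨x, D.frame l x s⟩).2) (closure (D.U l) ∩ e.baseSet) :=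
      continuous_snd.comp_continuousOn
        (e.continuousOn.comp h1 fun x hx => e.mem_source.2 hx.2)
    exact ((ContinuousLinearMap.smulRightL ℂ _ F
      (ContinuousLinearMap.proj s :
        (Fin (Module.finrank ℂ F) → ℂ) →L[ℂ] ℂ)).continuous).comp_continuousOn h2
  have hkey : ∀ x ∈ closure (D.U l) ∩ e.baseSet, ∃ g : (Fin (Module.finrank ℂ F) → ℂ) ≃L[ℂ] F,
      Φ x = g ∧ ∀ s, g.symm f s = (D.frame l x).repr (e.symm x f) s := by
    intro x hx
    let g₀ : (Fin (Module.finrank ℂ F) → ℂ) ≃ₗ[ℂ] F :=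
      (D.frame l x).equivFun.symm.trans (e.linearEquivAt ℂ x hx.2)
    refine ⟨g₀.toContinuousLinearEquiv, ?_, ?_⟩
    · ext c
      simp [hΦ, g₀, Module.Basis.equivFun_symm_apply]
    · intro s
      change (D.frame l x).equivFun ((e.linearEquivAt ℂ x hx.2).symm f) s = _
      rfl
  have hinv : ContinuousOn (fun x => ContinuousLinearMap.inverse (Φ x))
      (closure (D.U l) ∩ e.baseSet) := fun x hx => by
    obtain ⟨g, hg, -⟩ := hkey x hx
    exact continuousWithinAt_inverse_clm (hΦc x hx) g hg
  have hmain : ContinuousOn (fun x => ∑ s, (ContinuousLinearMap.inverse (Φ x) f) s •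
      D.emb l x (D.frame l x s)) (closure (D.U l) ∩ e.baseSet) := by
    refine continuousOn_finsetSum _ fun s _ => ContinuousOn.smul
      (f := fun x => (ContinuousLinearMap.inverse (Φ x) f) s)
      (g := fun x => D.emb l x (D.frame l x s)) ?_ ((D.continuousOn_emb_frame l s).mono Set.inter_subset_left)
    exact (continuous_apply s).comp_continuousOn (hinv.clm_apply continuousOn_const)
  refine hmain.congr fun x hx => ?_
  obtain ⟨g, hg, hs⟩ := hkey x hx
  simp only [hg, ContinuousLinearMap.inverse_equiv, ContinuousLinearEquiv.coe_coe, hs]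
  conv_lhs => rw [← (D.frame l x).sum_repr (e.symm x f), map_sum]
  simp

/-- The embedding `i` is continuous on sections that are constant in a local trivialization. -/
theorem continuousOn_i_symm (p : M) (f : F) :
    ContinuousOn (fun x => D.i x ((trivializationAt F E p).symm x f))
      (trivializationAt F E p).baseSet := by
  set e := trivializationAt F E p with he
  refine (PiLp.continuous_toLp 2 _).comp_continuousOn (continuousOn_pi.2 fun l => ?_)
  intro x hx
  refine ContinuousAt.continuousWithinAt ?_
  by_cases hxU : x ∈ D.U l
  · have hn : closure (D.U l) ∩ e.baseSet ∈ nhds x :=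
      Filter.inter_mem (Filter.mem_of_superset ((D.isOpen_U l).mem_nhds hxU) subset_closure)
        (e.open_baseSet.mem_nhds hx)
    exact (Complex.continuous_ofReal.comp (D.ψ_smooth l).continuous).continuousAt.smul
      ((D.continuousOn_emb_symm p f l).continuousAt hn)
  · have hx' : x ∉ tsupport (D.ψ l) := fun h => hxU (D.ψ_support l h)
    have h0 : ∀ᶠ y in nhds x, D.ψ l y = 0 := by
      filter_upwards [(isClosed_tsupport (D.ψ l)).isOpen_compl.mem_nhds hx'] with y hy
      exact image_eq_zero_of_notMem_tsupport hy
    refine (continuousAt_const (y := 0)).congr ?_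
    filter_upwards [h0] with y hy
    simp [hy]

variable [FiniteDimensional ℂ F] [∀ x, FiniteDimensional ℂ (E x)]

/-- The endomorphism `i i^*` of `V`, the projection onto the image of `E`, depends continuously on
the base point: it is `Q (Q^* Q)⁻¹ Q^*` when `Q` is the composition of `i` with a local
trivialization. -/
theorem continuous_inner_adjoint_i (v v' : D.V) :
    Continuous fun x => (inner ℂ (LinearMap.adjoint (D.i x) v)
      (LinearMap.adjoint (D.i x) v') : ℂ) := by
  rw [continuous_iff_continuousAt]
  intro p
  set e := trivializationAt F E p with he
  have hp : p ∈ e.baseSet := FiberBundle.mem_baseSet_trivializationAt' p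
  let H := EuclideanSpace ℂ (Fin (Module.finrank ℂ F))
  let j : H ≃L[ℂ] F := ContinuousLinearEquiv.ofFinrankEq (by simp [H])
  let Q : M → H →L[ℂ] D.V := fun x =>
    LinearMap.toContinuousLinearMap
      ((D.i x) ∘ₗ (e.symmL ℂ x : F →ₗ[ℂ] E x) ∘ₗ (j : H →ₗ[ℂ] F))
  have hQ : ∀ x ∈ e.baseSet, ∀ w, Q x w = D.i x (e.symm x (j w)) := fun x hx w => by
    simp [Q, e.symmL_apply hx]
  have hQc : ContinuousOn Q e.baseSet :=
    continuousOn_clm_apply.2 fun w =>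
      (D.continuousOn_i_symm p (j w)).congr fun x hx => hQ x hx w
  let R : M → H →L[ℂ] H := fun x => (ContinuousLinearMap.adjoint (Q x)).comp (Q x)
  have hadj : ContinuousOn (fun x => ContinuousLinearMap.adjoint (Q x)) e.baseSet :=
    (ContinuousLinearMap.adjoint (𝕜 := ℂ) (E := H) (F := D.V)).continuous.comp_continuousOn hQc
  have hRc : ContinuousOn R e.baseSet := hadj.clm_comp hQc
  have hQinj : ∀ x ∈ e.baseSet, ∀ w, Q x w = 0 → w = 0 := by
    intro x hx w hw
    rw [hQ x hx] at hw
    have h1 : e.symm x (j w) = 0 := by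
      rw [← norm_eq_zero, ← D.norm_i, hw, norm_zero]
    have h2 : j w = 0 := by
      have : (e.linearEquivAt ℂ x hx).symm (j w) = 0 := h1
      exact (LinearEquiv.map_eq_zero_iff _).1 this
    exact (ContinuousLinearEquiv.map_eq_zero_iff _).1 h2
  have hR : ∀ x ∈ e.baseSet, ∃ g : H ≃L[ℂ] H, R x = g := by
    intro x hx
    have hinj : Function.Injective (R x : H →ₗ[ℂ] H) := by
      rw [← LinearMap.ker_eq_bot, LinearMap.ker_eq_bot']
      intro w hw
      refine hQinj x hx w ?_
      have : inner ℂ (Q x w) (Q x w) = (0 : ℂ) := by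
        rw [← ContinuousLinearMap.adjoint_inner_left]
        have hw' : ContinuousLinearMap.adjoint (Q x) (Q x w) = 0 := hw
        rw [hw', inner_zero_left]
      exact inner_self_eq_zero.1 this
    exact ⟨(LinearEquiv.ofInjectiveEndo _ hinj).toContinuousLinearEquiv, by ext w; rfl⟩
  have hinv : ContinuousOn (fun x => ContinuousLinearMap.inverse (R x)) e.baseSet := fun x hx => by
    obtain ⟨g, hg⟩ := hR x hx
    exact continuousWithinAt_inverse_clm (hRc x hx) g hg
  have hmain : ContinuousOn (fun x => (inner ℂ v (Q x (ContinuousLinearMap.inverse (R x)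
      (ContinuousLinearMap.adjoint (Q x) v'))) : ℂ)) e.baseSet :=
    ContinuousOn.inner continuousOn_const
      (hQc.clm_apply (hinv.clm_apply (hadj.clm_apply continuousOn_const)))
  refine (hmain.congr fun x hx => ?_).continuousAt (e.open_baseSet.mem_nhds hp)
  obtain ⟨g, hg⟩ := hR x hx
  set y := LinearMap.adjoint (D.i x) v' with hy
  set w : H := j.symm (e.linearEquivAt ℂ x hx y) with hw
  have hsymm : e.symm x (j w) = y := by
    have : (e.linearEquivAt ℂ x hx).symm (j w) = y := by
      rw [hw, j.apply_symm_apply, LinearEquiv.symm_apply_apply]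
    exact this
  have hQw : Q x w = D.i x y := by rw [hQ x hx, hsymm]
  have hRw : R x w = ContinuousLinearMap.adjoint (Q x) v' := by
    refine ext_inner_right ℂ fun z => ?_
    change inner ℂ (ContinuousLinearMap.adjoint (Q x) (Q x w)) z = _
    rw [ContinuousLinearMap.adjoint_inner_left, ContinuousLinearMap.adjoint_inner_left, hQw, hQ x hx,
      D.inner_i, hy, LinearMap.adjoint_inner_left]
  have hback : ContinuousLinearMap.inverse (R x) (ContinuousLinearMap.adjoint (Q x) v') = w := by
    rw [← hRw, hg, ContinuousLinearMap.inverse_equiv]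
    simp
  rw [hback, hQw, LinearMap.adjoint_inner_left]

end EmbeddingData

end Embedding

section Delta

variable {N : ℕ} {M : Type*} [EMetricSpace M] [CompactSpace M]
  [ChartedSpace (EuclideanSpace ℝ (Fin N)) M]
  {F : Type*} [NormedAddCommGroup F] [NormedSpace ℂ F]
  {E : M → Type*} [TopologicalSpace (TotalSpace F E)]
  [∀ x, NormedAddCommGroup (E x)] [∀ x, InnerProductSpace ℂ (E x)]
  [FiberBundle F E]
  {A : Type*} [NormedAddCommGroup A] [NormedSpace ℝ A]
  {T₀ : SmoothTriangulation N M A} {ι : Type*} [Fintype ι] (D : EmbeddingData T₀ F E ι)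

namespace EmbeddingData

/-- Uniformly over the closure of `U_l`, the components of a vector in the `l`-th frame are bounded
by its norm: the vectors `i_l e_{l,s}` depend continuously on the point of a compact set and are
everywhere linearly independent. -/
theorem exists_sum_norm_repr_le (l : ι) : ∃ C : ℝ, 0 ≤ C ∧ ∀ x ∈ closure (D.U l), ∀ u : E x,
    ∑ s, ‖(D.frame l x).repr u s‖ ≤ C * ‖u‖ := by
  set Z := closure (D.U l) ×ˢ Metric.sphere (0 : Fin (Module.finrank ℂ F) → ℂ) 1 with hZ
  have hZc : IsCompact Z := (isClosed_closure.isCompact).prod (isCompact_sphere _ _)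
  set Θ : M × (Fin (Module.finrank ℂ F) → ℂ) → ℝ := fun z =>
    ‖∑ s, z.2 s • D.emb l z.1 (D.frame l z.1 s)‖ with hΘ
  have hΘc : ContinuousOn Θ Z := by
    refine ContinuousOn.norm (continuousOn_finsetSum _ fun s _ =>
      ContinuousOn.smul (f := fun z : M × (Fin (Module.finrank ℂ F) → ℂ) => z.2 s)
        (g := fun z => D.emb l z.1 (D.frame l z.1 s)) ?_ ?_)
    · fun_prop
    · exact (D.continuousOn_emb_frame l s).comp continuousOn_fst fun z hz => hz.1
  have hΘu : ∀ x ∈ closure (D.U l), ∀ u : E x,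
      Θ (x, fun s => (D.frame l x).repr u s) = ‖u‖ := by
    intro x hx u
    rw [← D.emb_isometry l x hx u]
    conv_rhs => rw [← (D.frame l x).sum_repr u, map_sum]
    simp [hΘ]
  have hΘpos : ∀ z ∈ Z, 0 < Θ z := by
    rintro ⟨x, c⟩ ⟨hx, hc⟩
    have h1 : Θ (x, c) = ‖(D.frame l x).equivFun.symm c‖ := by
      rw [← hΘu x hx]
      congr 2
      funext s
      exact (congrFun ((D.frame l x).equivFun.apply_symm_apply c) s).symm
    rw [h1, norm_pos_iff]
    intro h0
    rw [(D.frame l x).equivFun.symm.map_eq_zero_iff] at h0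
    simp [h0] at hc
  obtain ⟨m, hm, hmΘ⟩ : ∃ m : ℝ, 0 < m ∧ ∀ z ∈ Z, m ≤ Θ z := by
    rcases Z.eq_empty_or_nonempty with h | h
    · exact ⟨1, one_pos, by simp [h]⟩
    · obtain ⟨z, hz, hmin⟩ := hZc.exists_isMinOn h hΘc
      exact ⟨Θ z, hΘpos z hz, fun w hw => hmin hw⟩
  refine ⟨(Module.finrank ℂ F : ℝ) * m⁻¹, by positivity, fun x hx u => ?_⟩
  set c : Fin (Module.finrank ℂ F) → ℂ := fun s => (D.frame l x).repr u s with hc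
  have hcu : ‖c‖ ≤ m⁻¹ * ‖u‖ := by
    by_cases h0 : ‖c‖ = 0
    · rw [h0]; positivity
    · have hpos : 0 < ‖c‖ := lt_of_le_of_ne (norm_nonneg _) (Ne.symm h0)
      have h1 := hmΘ (x, (‖c‖⁻¹ : ℂ) • c) ⟨hx, by simp [norm_smul, h0]⟩
      have h2 : Θ (x, (‖c‖⁻¹ : ℂ) • c) = ‖c‖⁻¹ * ‖u‖ := by
        rw [← hΘu x hx u]
        simp only [hΘ, Pi.smul_apply, smul_assoc, ← Finset.smul_sum, norm_smul]
        simp [hc]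
      rw [h2, inv_mul_eq_div, le_div_iff₀ hpos] at h1
      rw [inv_mul_eq_div, le_div_iff₀ hm]
      linarith
  calc ∑ s, ‖c s‖ ≤ ∑ _s : Fin (Module.finrank ℂ F), ‖c‖ :=
        Finset.sum_le_sum fun s _ => norm_le_pi_norm c s
    _ = (Module.finrank ℂ F : ℝ) * ‖c‖ := by simp
    _ ≤ (Module.finrank ℂ F : ℝ) * m⁻¹ * ‖u‖ := by
        rw [mul_assoc]; gcongr

end EmbeddingData

/-- Heine–Cantor for finitely many maps on compact sets, with a common modulus. -/
theorem exists_delta_of_continuousOn {X G : Type*} [EMetricSpace X] [NormedAddCommGroup G]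
    {κ : Type*} [Finite κ] (K : κ → Set X) (hK : ∀ k, IsCompact (K k)) (g : κ → X → G)
    (hg : ∀ k, ContinuousOn (g k) (K k)) {ε : ℝ} (hε : 0 < ε) :
    ∃ δ : ℝ, 0 < δ ∧ ∀ k, ∀ x ∈ K k, ∀ y ∈ K k, edist x y < ENNReal.ofReal δ →
      ‖g k x - g k y‖ ≤ ε := by
  have h : ∀ k, ∀ᶠ δ : ℝ in nhdsWithin 0 (Set.Ioi 0), ∀ x ∈ K k, ∀ y ∈ K k,
      edist x y < ENNReal.ofReal δ → ‖g k x - g k y‖ ≤ ε := by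
    intro k
    have hu := (hK k).uniformContinuousOn_of_continuous (hg k)
    rw [EMetric.uniformContinuousOn_iff] at hu
    obtain ⟨η, hη, h⟩ := hu (ENNReal.ofReal ε) (by simpa using hε)
    have hev : ∀ᶠ δ : ℝ in nhdsWithin 0 (Set.Ioi 0), ENNReal.ofReal δ < η := by
      have : Filter.Tendsto ENNReal.ofReal (nhdsWithin 0 (Set.Ioi 0)) (nhds (ENNReal.ofReal 0)) :=
        (ENNReal.continuous_ofReal.tendsto 0).mono_left nhdsWithin_le_nhds
      rw [ENNReal.ofReal_zero] at this
      exact this.eventually_lt_const hη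
    filter_upwards [hev] with δ hδ x hx y hy hxy
    have := h hx hy (hxy.trans hδ)
    rw [edist_dist, ENNReal.ofReal_lt_ofReal_iff hε, dist_eq_norm] at this
    exact this.le
  obtain ⟨δ, hδ, hpos⟩ := ((Filter.eventually_all.2 h).and self_mem_nhdsWithin).exists
  exact ⟨δ, hpos, hδ⟩

end Delta

/-! ### The embedding with coefficients averaged over the vertices -/

/-- The mean of a family of vectors. -/
def mean {κ V : Type*} [Fintype κ] [AddCommGroup V] [Module ℝ V] (g : κ → V) : V :=
  (Fintype.card κ : ℝ)⁻¹ • ∑ k, g k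

theorem mean_mem_of_convex {κ V : Type*} [Fintype κ] [Nonempty κ] [AddCommGroup V] [Module ℝ V]
    {s : Set V} (hs : Convex ℝ s) {g : κ → V} (hg : ∀ k, g k ∈ s) : mean g ∈ s := by
  have h := hs.sum_mem (t := Finset.univ) (w := fun _ : κ => (Fintype.card κ : ℝ)⁻¹) (z := g)
    (fun _ _ => by positivity) (by simp) (fun k _ => hg k)
  rwa [← Finset.smul_sum] at h

theorem norm_sub_mean_le {κ V : Type*} [Fintype κ] [Nonempty κ] [NormedAddCommGroup V]
    [NormedSpace ℝ V] {g : κ → V} {a : V} {ε : ℝ} (h : ∀ k, ‖a - g k‖ ≤ ε) :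
    ‖a - mean g‖ ≤ ε := by
  have := mean_mem_of_convex (convex_closedBall a ε) (g := g) fun k => by
    rw [mem_closedBall_iff_norm']; exact h k
  rwa [mem_closedBall_iff_norm'] at this

theorem exists_pos_forall_le {κ : Type*} [Finite κ] {δ : κ → ℝ} (h : ∀ k, 0 < δ k) :
    ∃ d : ℝ, 0 < d ∧ ∀ k, d ≤ δ k := by
  have h1 : ∀ᶠ d : ℝ in nhdsWithin 0 (Set.Ioi 0), ∀ k, d ≤ δ k :=
    Filter.eventually_all.2 fun k =>
      ((eventually_lt_nhds (h k)).filter_mono nhdsWithin_le_nhds).mono fun _ => le_of_lt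
  obtain ⟨d, hd, hd0⟩ := (h1.and self_mem_nhdsWithin).exists
  exact ⟨d, hd0, hd⟩

section Delta

variable {N : ℕ} {M : Type*} [EMetricSpace M] [CompactSpace M]
  [ChartedSpace (EuclideanSpace ℝ (Fin N)) M]
  {F : Type*} [NormedAddCommGroup F] [NormedSpace ℂ F]
  {E : M → Type*} [TopologicalSpace (TotalSpace F E)]
  [∀ x, NormedAddCommGroup (E x)] [∀ x, InnerProductSpace ℂ (E x)]
  [FiberBundle F E]
  {A : Type*} [NormedAddCommGroup A] [NormedSpace ℝ A]
  {T₀ : SmoothTriangulation N M A} {ι : Type*} [Fintype ι] (D : EmbeddingData T₀ F E ι)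

namespace EmbeddingData

open Classical in
/-- The value on one simplex of `I c`, for a vector `u` over the reference point `p`: the matrices
of the `i_l` and the functions `ψ_l` are replaced by their means over the points `y`, the vertices
of the simplex; only those `l` contribute for which the simplex `S` lies in the closure of
`U_l`. -/
def meanEmbedding {κ : Type*} [Fintype κ] (S : Set M) (y : κ → M) {p : M} (u : E p) : D.V :=
  WithLp.toLp 2 fun l =>
    if S ⊆ closure (D.U l) then
      (mean fun k => D.ψ l (y k)) • ∑ s, (D.frame l p).repr u s •
        mean fun k => D.emb l (y k) (D.frame l (y k) s)
    else 0

/-- On small sets the mean embedding is so close to `i` that composing it with `i^*` leaves it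
injective. -/
theorem exists_delta_meanEmbedding [∀ x, FiniteDimensional ℂ (E x)] :
    ∃ δ : ℝ, 0 < δ ∧ ∀ S : Set M, Metric.ediam S < ENNReal.ofReal δ →
      ∀ {κ : Type*} [Fintype κ] [Nonempty κ] (y : κ → M), (∀ k, y k ∈ S) → ∀ p ∈ S, ∀ u : E p,
        LinearMap.adjoint (D.i p) (D.meanEmbedding S y u) = 0 → u = 0 := by
  classical
  choose C hC0 hC using D.exists_sum_norm_repr_le
  obtain ⟨B, hB0, hB⟩ : ∃ B : ℝ, 0 ≤ B ∧ ∀ l, C l ≤ B :=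
    ⟨∑ l, C l, Finset.sum_nonneg fun l _ => hC0 l,
      fun l => Finset.single_le_sum (fun l _ => hC0 l) (Finset.mem_univ l)⟩
  set n : ℝ := (Fintype.card ι : ℝ) with hn
  have hn0 : 0 ≤ n := Nat.cast_nonneg _
  -- with this `ε` the errors `ε B` (of the frames) and `ε n` (of the cutoffs) are at most `1 / 2`
  set ε : ℝ := (2 * (B + 1) * (n + 1))⁻¹ with hε
  have hε0 : 0 < ε := by positivity
  have hεB : ε * B ≤ 1 / 2 := by
    rw [hε, inv_mul_eq_div, div_le_iff₀ (by positivity)]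
    nlinarith
  have hεn : ε * n ≤ 1 / 2 := by
    rw [hε, inv_mul_eq_div, div_le_iff₀ (by positivity)]
    nlinarith
  obtain ⟨δ₁, hδ₁, h₁⟩ := exists_delta_of_continuousOn (fun _ : ι => (Set.univ : Set M))
    (fun _ => isCompact_univ) D.ψ (fun l => (D.ψ_smooth l).continuous.continuousOn) hε0
  have h₂ : ∀ s, ∃ δ : ℝ, 0 < δ ∧ ∀ l, ∀ x ∈ closure (D.U l), ∀ z ∈ closure (D.U l),
      edist x z < ENNReal.ofReal δ →
        ‖D.emb l x (D.frame l x s) - D.emb l z (D.frame l z s)‖ ≤ ε := by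
    intro s
    have h : ∀ l, ∃ δ : ℝ, 0 < δ ∧ ∀ _ : Unit, ∀ x ∈ closure (D.U l), ∀ z ∈ closure (D.U l),
      edist x z < ENNReal.ofReal δ →
        ‖D.emb l x (D.frame l x s) - D.emb l z (D.frame l z s)‖ ≤ ε := fun l =>
      exists_delta_of_continuousOn (fun _ : Unit => closure (D.U l))
        (fun _ => isClosed_closure.isCompact) (fun _ x => D.emb l x (D.frame l x s))
        (fun _ => D.continuousOn_emb_frame l s) hε0
    choose δ hδ h using h
    obtain ⟨d, hd, hdl⟩ := exists_pos_forall_le hδ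
    exact ⟨d, hd, fun l x hx z hz hxz =>
      h l () x hx z hz (hxz.trans_le (ENNReal.ofReal_le_ofReal (hdl l)))⟩
  choose δ₂' hδ₂' h₂ using h₂
  obtain ⟨δ₂, hδ₂, hδ₂l⟩ := exists_pos_forall_le hδ₂'
  have h₃ : ∀ l, ∃ δ : ℝ, 0 < δ ∧ Metric.thickening δ (tsupport (D.ψ l)) ⊆ D.U l := fun l =>
    (isClosed_tsupport _).isCompact.exists_thickening_subset_open (D.isOpen_U l) (D.ψ_support l)
  choose δ₃' hδ₃' h₃ using h₃
  obtain ⟨δ₃, hδ₃, hδ₃l⟩ := exists_pos_forall_le hδ₃'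
  refine ⟨min δ₁ (min δ₂ δ₃), by positivity, ?_⟩
  intro S hS κ _ _ y hy p hp u hu
  by_contra hu0
  have hupos : 0 < ‖u‖ := norm_pos_iff.2 hu0
  have hdist : ∀ z ∈ S, edist p z < ENNReal.ofReal (min δ₁ (min δ₂ δ₃)) := fun z hz =>
    (Metric.edist_le_ediam_of_mem hp hz).trans_lt hS
  have hterm : ∀ l, ‖u‖ ^ 2 / 2 * (D.ψ l p ^ 2 - ε) ≤
      D.ψ l p * (inner ℂ (D.emb l p u) (D.meanEmbedding S y u l) : ℂ).re := by
    intro l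
    by_cases h0 : D.ψ l p = 0
    · rw [h0]
      have : 0 ≤ ‖u‖ ^ 2 / 2 * ε := by positivity
      nlinarith
    have hsub : S ⊆ closure (D.U l) := by
      intro z hz
      refine subset_closure (h₃ l ((Metric.mem_thickening_iff_exists_edist_lt _ _).2
        ⟨p, subset_tsupport _ h0, ?_⟩))
      rw [edist_comm]
      refine (hdist z hz).trans_le (ENNReal.ofReal_le_ofReal ?_)
      exact ((min_le_right _ _).trans (min_le_right _ _)).trans (hδ₃l l)
    set b := ∑ s, (D.frame l p).repr u s • mean fun k => D.emb l (y k) (D.frame l (y k) s) with hb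
    set m := mean fun k => D.ψ l (y k) with hm
    have hX : D.meanEmbedding S y u l = m • b := by
      simp [meanEmbedding, hsub, hm, hb]
    have hm0 : 0 ≤ m := mean_mem_of_convex (convex_Ici (0 : ℝ)) fun k => D.ψ_nonneg l (y k)
    have hmψ : D.ψ l p - ε ≤ m := by
      have : ‖D.ψ l p - m‖ ≤ ε := norm_sub_mean_le fun k =>
        h₁ l p (Set.mem_univ _) (y k) (Set.mem_univ _)
          ((hdist _ (hy k)).trans_le (ENNReal.ofReal_le_ofReal (min_le_left _ _)))
      rw [Real.norm_eq_abs] at this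
      linarith [(abs_le.1 this).2]
    have hbu : ‖D.emb l p u - b‖ ≤ ‖u‖ / 2 := by
      have hexp : D.emb l p u = ∑ s, (D.frame l p).repr u s • D.emb l p (D.frame l p s) := by
        conv_lhs => rw [← (D.frame l p).sum_repr u, map_sum]
        simp
      rw [hexp, hb, ← Finset.sum_sub_distrib]
      calc _ ≤ ∑ s, ‖(D.frame l p).repr u s‖ * ε := by
            refine (norm_sum_le _ _).trans (Finset.sum_le_sum fun s _ => ?_)
            rw [← smul_sub, norm_smul]
            refine mul_le_mul_of_nonneg_left (norm_sub_mean_le fun k => ?_) (norm_nonneg _)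
            refine h₂ s l p (hsub hp) (y k) (hsub (hy k))
              ((hdist _ (hy k)).trans_le (ENNReal.ofReal_le_ofReal ?_))
            exact ((min_le_right _ _).trans (min_le_left _ _)).trans (hδ₂l s)
        _ ≤ (B * ‖u‖) * ε := by
            rw [← Finset.sum_mul]
            refine mul_le_mul_of_nonneg_right ((hC l p (hsub hp) u).trans ?_) hε0.le
            exact mul_le_mul_of_nonneg_right (hB l) hupos.le
        _ ≤ ‖u‖ / 2 := by nlinarith
    have hre : ‖u‖ ^ 2 / 2 ≤ (inner ℂ (D.emb l p u) b : ℂ).re := by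
      have hw : ‖D.emb l p u‖ = ‖u‖ := D.emb_isometry l p (hsub hp) u
      have h1 : (inner ℂ (D.emb l p u) b : ℂ).re =
          ‖u‖ ^ 2 - (inner ℂ (D.emb l p u) (D.emb l p u - b) : ℂ).re := by
        have h2 : (inner ℂ (D.emb l p u) (D.emb l p u) : ℂ).re = ‖D.emb l p u‖ ^ 2 :=
          inner_self_eq_norm_sq (𝕜 := ℂ) _
        rw [inner_sub_right, Complex.sub_re, h2, hw]
        ring
      have h3 : (inner ℂ (D.emb l p u) (D.emb l p u - b) : ℂ).re ≤ ‖u‖ * (‖u‖ / 2) := by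
        refine ((Complex.re_le_norm _).trans (norm_inner_le_norm _ _)).trans ?_
        rw [hw]
        exact mul_le_mul_of_nonneg_left hbu hupos.le
      rw [h1]
      nlinarith
    rw [hX, RCLike.real_smul_eq_coe_smul (K := ℂ) m b, inner_smul_right]
    have hre' : ((m : ℂ) * inner ℂ (D.emb l p u) b).re = m * (inner ℂ (D.emb l p u) b : ℂ).re :=
      Complex.re_ofReal_mul _ _
    change _ ≤ D.ψ l p * ((m : ℂ) * inner ℂ (D.emb l p u) b).re
    rw [hre']
    have hψ0 := D.ψ_nonneg l p
    have hψ1 := D.ψ_le_one l p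
    calc ‖u‖ ^ 2 / 2 * (D.ψ l p ^ 2 - ε) ≤ ‖u‖ ^ 2 / 2 * (D.ψ l p * m) := by
          refine mul_le_mul_of_nonneg_left ?_ (by positivity)
          nlinarith
      _ = D.ψ l p * (m * (‖u‖ ^ 2 / 2)) := by ring
      _ ≤ _ := mul_le_mul_of_nonneg_left (mul_le_mul_of_nonneg_left hre hm0) hψ0
  have hzero : ∑ l, D.ψ l p * (inner ℂ (D.emb l p u) (D.meanEmbedding S y u l) : ℂ).re = 0 := by
    have h1 : (inner ℂ (D.i p u) (D.meanEmbedding S y u) : ℂ) = 0 := by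
      rw [← LinearMap.adjoint_inner_right, hu, inner_zero_right]
    rw [PiLp.inner_apply] at h1
    have h2 := congrArg Complex.re h1
    rw [Complex.re_sum, Complex.zero_re] at h2
    rw [← h2]
    refine Finset.sum_congr rfl fun l _ => ?_
    have h3 : (D.i p u) l = (D.ψ l p : ℂ) • D.emb l p u := rfl
    rw [h3, inner_smul_left, Complex.conj_ofReal, Complex.re_ofReal_mul]
  have hsum := Finset.sum_le_sum fun l (_ : l ∈ Finset.univ) => hterm l
  rw [hzero, ← Finset.mul_sum, Finset.sum_sub_distrib, D.ψ_sq_sum] at hsum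
  simp only [Finset.sum_const, Finset.card_univ, nsmul_eq_mul, ← hn] at hsum
  have h3 : 0 < ‖u‖ ^ 2 / 2 := by positivity
  nlinarith

end EmbeddingData

end Delta

/-! ### The standard simplex and barycentric coordinates -/

section Corner

variable {N : ℕ}

/-- The linear part of `cornerCoord`. -/
def cornerLin (i : Fin (N + 1)) : EuclideanSpace ℝ (Fin N) →L[ℝ] ℝ :=
  Fin.cases (-∑ j, EuclideanSpace.proj j) (fun j => EuclideanSpace.proj j) i

/-- The barycentric coordinates of `ℝ^N` with respect to the points `0, e₁, …, e_N`. -/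
def cornerCoord (i : Fin (N + 1)) (t : EuclideanSpace ℝ (Fin N)) : ℝ :=
  (if i = 0 then 1 else 0) + cornerLin i t

@[simp] theorem cornerLin_succ (j : Fin N) (t : EuclideanSpace ℝ (Fin N)) :
    cornerLin j.succ t = t j := rfl

@[simp] theorem cornerLin_zero (t : EuclideanSpace ℝ (Fin N)) :
    cornerLin 0 t = -∑ j, t j := by
  simp [cornerLin]

@[simp] theorem cornerCoord_succ (j : Fin N) (t : EuclideanSpace ℝ (Fin N)) :
    cornerCoord j.succ t = t j := by
  simp [cornerCoord]

theorem sum_cornerLin (t : EuclideanSpace ℝ (Fin N)) : ∑ i, cornerLin i t = 0 := by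
  simp [Fin.sum_univ_succ]

theorem sum_cornerCoord (t : EuclideanSpace ℝ (Fin N)) : ∑ i, cornerCoord i t = 1 := by
  simp only [cornerCoord, Finset.sum_add_distrib, sum_cornerLin]
  simp

theorem cornerCoord_add (i : Fin (N + 1)) (t w : EuclideanSpace ℝ (Fin N)) :
    cornerCoord i (t + w) = cornerCoord i t + cornerLin i w := by
  simp [cornerCoord, add_assoc]

theorem hasFDerivAt_cornerCoord (i : Fin (N + 1)) (t : EuclideanSpace ℝ (Fin N)) :
    HasFDerivAt (cornerCoord i) (cornerLin i) t :=
  (cornerLin i).hasFDerivAt.const_add _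

theorem continuous_cornerCoord (i : Fin (N + 1)) : Continuous (cornerCoord (N := N) i) :=
  continuous_const.add (cornerLin i).continuous

/-- The point of `ℝ^N` with given barycentric coordinates. -/
def cornerPoint (w : Fin (N + 1) → ℝ) : EuclideanSpace ℝ (Fin N) :=
  WithLp.toLp 2 fun j => w j.succ

theorem cornerCoord_cornerPoint {w : Fin (N + 1) → ℝ} (hw : ∑ i, w i = 1) (i : Fin (N + 1)) :
    cornerCoord i (cornerPoint w) = w i := by
  rw [Fin.sum_univ_succ] at hw
  cases i using Fin.cases with
  | zero =>
    simp [cornerCoord, cornerPoint]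
    linarith
  | succ j => simp [cornerPoint]

theorem cornerPoint_cornerCoord (t : EuclideanSpace ℝ (Fin N)) :
    cornerPoint (fun i => cornerCoord i t) = t := by
  ext j
  simp [cornerPoint]

theorem cornerLin_sub (i j k : Fin (N + 1)) :
    cornerLin k (cornerPoint (Pi.single i 1) - cornerPoint (Pi.single j 1)) =
      (if i = k then 1 else 0) - if j = k then 1 else 0 := by
  have h := cornerCoord_add k (cornerPoint (Pi.single j 1))
    (cornerPoint (Pi.single i 1) - cornerPoint (Pi.single j 1))
  rw [add_sub_cancel, cornerCoord_cornerPoint (by simp), cornerCoord_cornerPoint (by simp)] at h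
  rw [Pi.single_apply, Pi.single_apply] at h
  simp only [eq_comm (a := k)] at h
  linarith

variable (N) in
/-- The closed simplex in `ℝ^N` with vertices `0, e₁, …, e_N`. -/
def corner : Set (EuclideanSpace ℝ (Fin N)) := {t | ∀ i, 0 ≤ cornerCoord i t}

variable (N) in
/-- The open simplex in `ℝ^N` with vertices `0, e₁, …, e_N`. -/
def openCorner : Set (EuclideanSpace ℝ (Fin N)) := {t | ∀ i, 0 < cornerCoord i t}

theorem openCorner_subset : openCorner N ⊆ corner N := fun _ ht i => (ht i).le

theorem isOpen_openCorner : IsOpen (openCorner N) := by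
  simp only [openCorner, Set.ofPred_forall]
  exact isOpen_iInter_of_finite fun i => isOpen_lt continuous_const (continuous_cornerCoord i)

theorem isClosed_corner : IsClosed (corner N) := by
  simp only [corner, Set.ofPred_forall]
  exact isClosed_iInter fun i => isClosed_le continuous_const (continuous_cornerCoord i)

theorem isCompact_corner : IsCompact (corner N) := by
  have hc : Continuous (cornerPoint (N := N)) :=
    (PiLp.continuous_toLp 2 _).comp (continuous_pi fun j => continuous_apply j.succ)
  refine ((isCompact_stdSimplex ℝ (Fin (N + 1))).image hc).of_isClosed_subset isClosed_corner ?_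
  intro t ht
  exact ⟨fun i => cornerCoord i t, ⟨ht, sum_cornerCoord t⟩, cornerPoint_cornerCoord t⟩

theorem convex_corner : Convex ℝ (corner N) := by
  intro x hx y hy a b ha hb hab i
  have h : cornerCoord i (a • x + b • y) = a * cornerCoord i x + b * cornerCoord i y := by
    simp only [cornerCoord, map_add, map_smul, smul_eq_mul]
    linear_combination (-(if i = 0 then (1 : ℝ) else 0)) * hab
  rw [h]
  have := hx i
  have := hy i
  positivity

/-- The barycentre of the simplex. -/
theorem cornerPoint_const_mem : cornerPoint (fun _ => ((N : ℝ) + 1)⁻¹) ∈ openCorner N := by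
  intro i
  rw [cornerCoord_cornerPoint]
  · positivity
  · simp only [Finset.sum_const, Finset.card_univ, Fintype.card_fin, nsmul_eq_mul, Nat.cast_add,
      Nat.cast_one]
    exact mul_inv_cancel₀ (by positivity)

theorem corner_subset_closure_openCorner : corner N ⊆ closure (openCorner N) := by
  intro t ht
  set b := cornerPoint (N := N) (fun _ => ((N : ℝ) + 1)⁻¹) with hb
  have hlim : Filter.Tendsto (fun r : ℝ => t + r • (b - t)) (nhdsWithin 0 (Set.Ioo 0 1)) (nhds t) := by
    have h : Continuous fun r : ℝ => t + r • (b - t) := by fun_prop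
    have h2 := h.tendsto 0
    simp only [zero_smul, add_zero] at h2
    exact h2.mono_left nhdsWithin_le_nhds
  have : (nhdsWithin (0 : ℝ) (Set.Ioo 0 1)).NeBot := left_nhdsWithin_Ioo_neBot one_pos
  refine mem_closure_of_tendsto hlim ?_
  filter_upwards [self_mem_nhdsWithin] with r hr i
  have hbi := cornerPoint_const_mem (N := N) i
  rw [← hb] at hbi
  have h1 : cornerCoord i b = cornerCoord i t + cornerLin i (b - t) := by
    rw [← cornerCoord_add, add_sub_cancel]
  rw [cornerCoord_add, map_smul, smul_eq_mul]
  have hti := ht i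
  nlinarith [hr.1, hr.2, mul_pos hr.1 hbi, mul_nonneg (sub_nonneg.2 hr.2.le) hti]

theorem openCorner_mem_nhds {t : EuclideanSpace ℝ (Fin N)} (ht : t ∈ openCorner N) :
    corner N ∈ nhds t :=
  Filter.mem_of_superset (isOpen_openCorner.mem_nhds ht) openCorner_subset

theorem uniqueDiffOn_corner : UniqueDiffOn ℝ (corner N) :=
  uniqueDiffOn_convex convex_corner
    ⟨_, mem_interior_iff_mem_nhds.2 (openCorner_mem_nhds cornerPoint_const_mem)⟩

end Corner

section FaceCoord

variable {N : ℕ} {A : Type*}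

open Classical in
/-- The barycentric coordinate of the vertex `u` on the simplex with vertices `v₀, …, v_N`; it
vanishes if `u` is not one of them. -/
def faceCoord (v : Fin (N + 1) → A) (u : A) (t : EuclideanSpace ℝ (Fin N)) : ℝ :=
  ∑ i, if v i = u then cornerCoord i t else 0

open Classical in
/-- The differential of `faceCoord`. -/
def faceLin (v : Fin (N + 1) → A) (u : A) : EuclideanSpace ℝ (Fin N) →L[ℝ] ℝ :=
  ∑ i, if v i = u then cornerLin i else 0

theorem hasFDerivAt_faceCoord (v : Fin (N + 1) → A) (u : A) (t : EuclideanSpace ℝ (Fin N)) :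
    HasFDerivAt (faceCoord v u) (faceLin v u) t := by
  unfold faceCoord faceLin
  refine HasFDerivAt.fun_sum fun i _ => ?_
  split_ifs
  · exact hasFDerivAt_cornerCoord i t
  · exact hasFDerivAt_const _ _

theorem continuous_faceCoord (v : Fin (N + 1) → A) (u : A) : Continuous (faceCoord v u) :=
  continuous_iff_continuousAt.2 fun t => (hasFDerivAt_faceCoord v u t).continuousAt

theorem faceCoord_apply {v : Fin (N + 1) → A} (hv : Function.Injective v) (i : Fin (N + 1))
    (t : EuclideanSpace ℝ (Fin N)) : faceCoord v (v i) t = cornerCoord i t := by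
  classical
  simp [faceCoord, hv.eq_iff]

/-- The sequence `v` lists the elements of `s` without repetition. -/
structure Enumerates {n : ℕ} (v : Fin n → A) (s : Finset A) : Prop where
  injective : Function.Injective v
  mem : ∀ i, v i ∈ s
  exists_eq : ∀ u ∈ s, ∃ i, v i = u

theorem exists_enumerates {n : ℕ} {s : Finset A} (hs : s.card = n) :
    ∃ v : Fin n → A, Enumerates v s := by
  let e := s.equivFinOfCardEq hs
  exact ⟨fun i => e.symm i, Subtype.val_injective.comp e.symm.injective, fun i => (e.symm i).2,
    fun u hu => ⟨e ⟨u, hu⟩, by simp⟩⟩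

end FaceCoord

section SimplexMap

variable {N : ℕ} {A : Type*} [NormedAddCommGroup A] [NormedSpace ℝ A]

/-- The affine map from `ℝ^N` sending `0, e₁, …, e_N` to the points `v₀, …, v_N`. -/
def simplexMap (v : Fin (N + 1) → A) (t : EuclideanSpace ℝ (Fin N)) : A :=
  ∑ i, cornerCoord i t • v i

/-- The linear part of `simplexMap`. -/
def simplexMapLin (v : Fin (N + 1) → A) : EuclideanSpace ℝ (Fin N) →L[ℝ] A :=
  ∑ i, (cornerLin i).smulRight (v i)

theorem simplexMapLin_apply (v : Fin (N + 1) → A) (w : EuclideanSpace ℝ (Fin N)) :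
    simplexMapLin v w = ∑ i, cornerLin i w • v i := by
  simp [simplexMapLin]

theorem hasFDerivAt_simplexMap (v : Fin (N + 1) → A) (t : EuclideanSpace ℝ (Fin N)) :
    HasFDerivAt (simplexMap v) (simplexMapLin v) t := by
  unfold simplexMap simplexMapLin
  exact HasFDerivAt.fun_sum fun i _ => (hasFDerivAt_cornerCoord i t).smul_const (v i)

theorem contDiff_simplexMap (v : Fin (N + 1) → A) : ContDiff ℝ ∞ (simplexMap v) := by
  unfold simplexMap cornerCoord
  exact ContDiff.sum fun i _ => (contDiff_const.add (cornerLin i).contDiff).smul contDiff_const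

theorem simplexMap_mem {v : Fin (N + 1) → A} {s : Finset A} (hv : ∀ i, v i ∈ s)
    {t : EuclideanSpace ℝ (Fin N)} (ht : t ∈ corner N) :
    simplexMap v t ∈ convexHull ℝ (s : Set A) :=
  (convex_convexHull ℝ _).sum_mem (fun i _ => ht i) (sum_cornerCoord t)
    fun i _ => subset_convexHull ℝ _ (hv i)

/-- A list of points containing the vertices of a simplex, possibly with repetitions, parametrizes
the simplex by `corner N`; one may use only the places `r u` chosen for the vertices `u`. -/
theorem exists_simplexMap_eq {v : Fin (N + 1) → A} {s : Finset A} {r : A → Fin (N + 1)}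
    (hr : ∀ u ∈ s, v (r u) = u) {a : A} (ha : a ∈ convexHull ℝ (s : Set A)) :
    ∃ t ∈ corner N, simplexMap v t = a ∧ ∀ i, (∀ u ∈ s, r u ≠ i) → cornerCoord i t = 0 := by
  classical
  obtain ⟨w, hw0, hw1, hwa⟩ := Finset.mem_convexHull'.1 ha
  set w' : Fin (N + 1) → ℝ := fun i => ∑ u ∈ s, if r u = i then w u else 0 with hw'
  have hsum : ∑ i, w' i = 1 := by
    rw [← hw1, hw', Finset.sum_comm]
    simp
  have hc := cornerCoord_cornerPoint hsum
  refine ⟨cornerPoint w', ?_, ?_, ?_⟩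
  · intro i
    rw [hc]
    exact Finset.sum_nonneg fun u hu => by split_ifs <;> simp [hw0 u hu]
  · simp only [simplexMap, hc]
    rw [← hwa]
    simp only [hw', Finset.sum_smul, ite_smul, zero_smul]
    rw [Finset.sum_comm]
    refine Finset.sum_congr rfl fun u hu => ?_
    simp [hr u hu]
  · intro i hi
    rw [hc]
    exact Finset.sum_eq_zero fun u hu => if_neg (hi u hu)

theorem simplexMapLin_mem_vectorSpan {v : Fin (N + 1) → A} {s : Finset A} (hv : ∀ i, v i ∈ s)
    (w : EuclideanSpace ℝ (Fin N)) : simplexMapLin v w ∈ vectorSpan ℝ (s : Set A) := by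
  have h : simplexMapLin v w = ∑ i, cornerLin i w • (v i - v 0) := by
    simp only [simplexMapLin_apply, smul_sub, Finset.sum_sub_distrib, ← Finset.sum_smul,
      sum_cornerLin, zero_smul, sub_zero]
  rw [h]
  exact Submodule.sum_mem _ fun i _ => Submodule.smul_mem _ _
    (vsub_mem_vectorSpan ℝ (hv i) (hv 0))

theorem simplexMapLin_injective {v : Fin (N + 1) → A} (hv : AffineIndependent ℝ v)
    {w : EuclideanSpace ℝ (Fin N)} (hw : simplexMapLin v w = 0) : w = 0 := by
  have h := affineIndependent_iff.1 hv Finset.univ (fun i => cornerLin i w) (sum_cornerLin w)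
    (by rw [← simplexMapLin_apply, hw])
  ext j
  simpa using h j.succ (Finset.mem_univ _)

theorem bary_eq {K : Geometry.SimplicialComplex ℝ A} {a : A} {w : A → ℝ}
    (h : IsBarycentric K a w) (u : A) : bary K u a = w u := by
  have hex : ∃ w, IsBarycentric K a w := ⟨w, h⟩
  rw [bary, dif_pos hex, hex.choose_spec.unique h]

theorem bary_eq_zero_of_notMem {K : Geometry.SimplicialComplex ℝ A} {s : Finset A}
    (hs : s ∈ K.faces) {a : A} (ha : a ∈ convexHull ℝ (s : Set A)) {u : A} (hu : u ∉ s) :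
    bary K u a = 0 := by
  classical
  obtain ⟨w, h0, h1, h2⟩ := Finset.mem_convexHull'.1 ha
  have hb : IsBarycentric K a (fun v => if v ∈ s then w v else 0) := by
    refine ⟨s, hs, fun v => ?_, fun v hv => if_neg hv, ?_, ?_⟩
    · by_cases hv : v ∈ s
      · simpa [hv] using h0 v hv
      · simp [hv]
    · rw [← h1]
      exact Finset.sum_congr rfl fun v hv => by simp [hv]
    · rw [← h2]
      exact Finset.sum_congr rfl fun v hv => by simp [hv]
  rw [bary_eq hb, if_neg hu]

theorem isBarycentric_faceCoord {K : Geometry.SimplicialComplex ℝ A} {s : Finset A}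
    (hs : s ∈ K.faces) {v : Fin (N + 1) → A} (hv : ∀ i, v i ∈ s)
    {t : EuclideanSpace ℝ (Fin N)} (ht : t ∈ corner N) :
    IsBarycentric K (simplexMap v t) fun u => faceCoord v u t := by
  classical
  refine ⟨s, hs, fun u => ?_, fun u hu => ?_, ?_, ?_⟩
  · exact Finset.sum_nonneg fun i _ => by split_ifs <;> simp [ht i]
  · exact Finset.sum_eq_zero fun i _ => if_neg fun h : v i = u => hu (h ▸ hv i)
  · unfold faceCoord
    rw [Finset.sum_comm]
    simp only [Finset.sum_ite_eq, hv, if_true]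
    exact sum_cornerCoord t
  · unfold faceCoord
    simp only [Finset.sum_smul, ite_smul, zero_smul]
    rw [Finset.sum_comm]
    simp only [Finset.sum_ite_eq, hv, if_true]
    rfl

theorem Enumerates.affineIndependent {v : Fin (N + 1) → A} {s : Finset A} (hv : Enumerates v s)
    {K : Geometry.SimplicialComplex ℝ A} (hs : s ∈ K.faces) : AffineIndependent ℝ v :=
  (K.indep hs).comp_embedding
    ⟨fun i => (⟨v i, hv.mem i⟩ : s), fun _ _ h => hv.injective (congrArg Subtype.val h)⟩

theorem Enumerates.exists_simplexMap_eq {v : Fin (N + 1) → A} {s : Finset A}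
    (hv : Enumerates v s) {a : A} (ha : a ∈ convexHull ℝ (s : Set A)) :
    ∃ t ∈ corner N, simplexMap v t = a := by
  classical
  obtain ⟨t, ht, hta, -⟩ := TwistedWhitney.exists_simplexMap_eq (v := v)
    (r := fun u => if h : ∃ i, v i = u then h.choose else 0) (s := s) (fun u hu => by
      have h := hv.exists_eq u hu
      rw [dif_pos h]
      exact h.choose_spec) ha
  exact ⟨t, ht, hta⟩

end SimplexMap

/-! ### Top-dimensional cells and their parametrizations -/

section InverseFunction

variable {N : ℕ} {M : Type*} [TopologicalSpace M] [ChartedSpace (EuclideanSpace ℝ (Fin N)) M]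

/-- The inverse function theorem for a map from `ℝ^N` to a manifold of dimension `N`. -/
theorem exists_local_right_inverse {f : EuclideanSpace ℝ (Fin N) → M}
    {t : EuclideanSpace ℝ (Fin N)}
    (hf : ContMDiffAt 𝓘(ℝ, EuclideanSpace ℝ (Fin N)) (𝓡 N) ∞ f t)
    (hinj : ∀ w, mfderiv 𝓘(ℝ, EuclideanSpace ℝ (Fin N)) (𝓡 N) f t w = 0 → w = 0) :
    ∃ G : M → EuclideanSpace ℝ (Fin N), G (f t) = t ∧
      MDifferentiableAt (𝓡 N) 𝓘(ℝ, EuclideanSpace ℝ (Fin N)) G (f t) ∧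
      ∀ᶠ y in nhds (f t), f (G y) = y := by
  set χ := extChartAt (𝓡 N) (f t) with hχ
  set h : EuclideanSpace ℝ (Fin N) → EuclideanSpace ℝ (Fin N) := fun z => χ (f z) with hh
  have hc : ContDiffAt ℝ ∞ h t := by
    have := (contMDiffAt_iff.1 hf).2
    rw [ModelWithCorners.range_eq_univ, contDiffWithinAt_univ] at this
    exact this
  -- the differential of `f`, read in the chart at `f t`
  let f' : EuclideanSpace ℝ (Fin N) →L[ℝ] EuclideanSpace ℝ (Fin N) :=
    mfderiv 𝓘(ℝ, EuclideanSpace ℝ (Fin N)) (𝓡 N) f t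
  have hd : HasFDerivAt h f' t := by
    have h1 : HasFDerivWithinAt h f' (Set.range (𝓡 N)) t :=
      (hf.mdifferentiableAt (by simp)).hasMFDerivAt.2
    rwa [ModelWithCorners.range_eq_univ, hasFDerivWithinAt_univ] at h1
  have hinj' : Function.Injective (f' : EuclideanSpace ℝ (Fin N) →ₗ[ℝ] EuclideanSpace ℝ (Fin N)) := by
    rw [← LinearMap.ker_eq_bot, LinearMap.ker_eq_bot']
    exact fun w hw => hinj w hw
  let e : EuclideanSpace ℝ (Fin N) ≃L[ℝ] EuclideanSpace ℝ (Fin N) :=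
    (LinearEquiv.ofInjectiveEndo _ hinj').toContinuousLinearEquiv
  have hF : HasFDerivAt h (e : EuclideanSpace ℝ (Fin N) →L[ℝ] EuclideanSpace ℝ (Fin N)) t := by
    have h2 : (e : EuclideanSpace ℝ (Fin N) →L[ℝ] EuclideanSpace ℝ (Fin N)) = f' := by
      ext w; rfl
    rwa [h2]
  have hn : (∞ : WithTop ℕ∞) ≠ 0 := by simp
  set g := hc.localInverse hF hn with hg
  have hgt : g (h t) = t := hc.localInverse_apply_image hF hn
  have hgc : ContDiffAt ℝ ∞ g (h t) := hc.to_localInverse hF hn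
  have hgr : ∀ᶠ z in nhds (h t), h (g z) = z :=
    (hc.hasStrictFDerivAt' hF hn).eventually_right_inverse
  have hχc : ContinuousAt χ (f t) := continuousAt_extChartAt (f t)
  have hgχ : ContinuousAt (fun y => g (χ y)) (f t) :=
    ContinuousAt.comp (f := χ) (g := g) (x := f t) hgc.continuousAt hχc
  refine ⟨fun y => g (χ y), hgt, ?_, ?_⟩
  · have h1 : MDifferentiableAt (𝓡 N) 𝓘(ℝ, EuclideanSpace ℝ (Fin N)) χ (f t) :=
      (contMDiffAt_extChartAt (n := ∞)).mdifferentiableAt (by simp)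
    have h2 : MDifferentiableAt 𝓘(ℝ, EuclideanSpace ℝ (Fin N))
        𝓘(ℝ, EuclideanSpace ℝ (Fin N)) g (χ (f t)) :=
      (hgc.differentiableAt (by simp)).mdifferentiableAt
    exact h2.comp (f t) h1
  · have h1 : ∀ᶠ y in nhds (f t), h (g (χ y)) = χ y := hχc.eventually hgr
    have h2 : ∀ᶠ y in nhds (f t), y ∈ χ.source := extChartAt_source_mem_nhds (f t)
    have h3 : ∀ᶠ y in nhds (f t), f (g (χ y)) ∈ χ.source := by
      have hcont : ContinuousAt (fun y => f (g (χ y))) (f t) := by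
        refine ContinuousAt.comp (g := f) ?_ hgχ
        change ContinuousAt f (g (h t))
        rw [hgt]
        exact hf.continuousAt
      refine hcont.eventually ?_
      change ∀ᶠ y in nhds (f (g (h t))), y ∈ χ.source
      rw [hgt]
      exact h2
    filter_upwards [h1, h2, h3] with y hy1 hy2 hy3
    exact χ.injOn hy3 hy2 hy1

end InverseFunction

section CellMap

variable {N : ℕ} {M : Type*} [TopologicalSpace M] [ChartedSpace (EuclideanSpace ℝ (Fin N)) M]
  {A : Type*} [NormedAddCommGroup A] [NormedSpace ℝ A]
  (T : SmoothTriangulation N M A) {s : Finset A} {v : Fin (N + 1) → A}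

namespace SmoothTriangulation

/-- The parametrization of the cell of `M` with vertices `v₀, …, v_N` by the simplex `corner N`. -/
def cellMap (v : Fin (N + 1) → A) (t : EuclideanSpace ℝ (Fin N)) : M := T.map (simplexMap v t)

variable {T}

theorem contMDiffOn_cellMap (hs : s ∈ T.K.faces) (hv : ∀ i, v i ∈ s) :
    ContMDiffOn 𝓘(ℝ, EuclideanSpace ℝ (Fin N)) (𝓡 N) ∞ (T.cellMap v) (corner N) :=
  (T.smooth_on_face s hs).comp (contDiff_simplexMap v).contMDiff.contMDiffOn
    fun _ ht => simplexMap_mem hv ht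

theorem uniqueMDiffOn_corner :
    UniqueMDiffOn 𝓘(ℝ, EuclideanSpace ℝ (Fin N)) (corner N) :=
  uniqueDiffOn_corner.uniqueMDiffOn

theorem inv_cellMap (hs : s ∈ T.K.faces) (hv : ∀ i, v i ∈ s) {t : EuclideanSpace ℝ (Fin N)}
    (ht : t ∈ corner N) : T.inv (T.cellMap v t) = simplexMap v t :=
  T.inv_map _ (T.K.convexHull_subset_space hs (simplexMap_mem hv ht))

theorem mu_cellMap (hs : s ∈ T.K.faces) (hv : ∀ i, v i ∈ s) {t : EuclideanSpace ℝ (Fin N)}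
    (ht : t ∈ corner N) (u : A) : T.mu u (T.cellMap v t) = faceCoord v u t := by
  rw [mu, inv_cellMap hs hv ht, bary_eq (isBarycentric_faceCoord hs hv ht)]

theorem mfderivWithin_cellMap_injective (hs : s ∈ T.K.faces) (hv : Enumerates v s)
    {t : EuclideanSpace ℝ (Fin N)} (ht : t ∈ corner N) {w : EuclideanSpace ℝ (Fin N)}
    (hw : mfderivWithin 𝓘(ℝ, EuclideanSpace ℝ (Fin N)) (𝓡 N) (T.cellMap v) (corner N) t w = 0) :
    w = 0 := by
  have hmem := simplexMap_mem hv.mem ht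
  have h1 := (hasFDerivAt_simplexMap v t).hasMFDerivAt
  have h2 := ((T.smooth_on_face s hs).mdifferentiableOn (by simp) _ hmem).hasMFDerivWithinAt
  have h3 := h2.comp t h1.hasMFDerivWithinAt (s := corner N)
    (fun z hz => simplexMap_mem hv.mem hz)
  have h4 := h3.mfderivWithin (uniqueMDiffOn_corner t ht)
  change mfderivWithin 𝓘(ℝ, EuclideanSpace ℝ (Fin N)) (𝓡 N) (T.map ∘ simplexMap v) (corner N) t w
    = 0 at hw
  rw [h4] at hw
  exact simplexMapLin_injective (hv.affineIndependent hs)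
    (T.immersive_on_face s hs _ hmem _ (simplexMapLin_mem_vectorSpan hv.mem w) hw)

theorem contMDiffAt_cellMap (hs : s ∈ T.K.faces) (hv : ∀ i, v i ∈ s)
    {t : EuclideanSpace ℝ (Fin N)} (ht : t ∈ openCorner N) :
    ContMDiffAt 𝓘(ℝ, EuclideanSpace ℝ (Fin N)) (𝓡 N) ∞ (T.cellMap v) t :=
  (contMDiffOn_cellMap hs hv).contMDiffAt (openCorner_mem_nhds ht)

theorem mfderiv_cellMap_injective (hs : s ∈ T.K.faces) (hv : Enumerates v s)
    {t : EuclideanSpace ℝ (Fin N)} (ht : t ∈ openCorner N) {w : EuclideanSpace ℝ (Fin N)}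
    (hw : mfderiv 𝓘(ℝ, EuclideanSpace ℝ (Fin N)) (𝓡 N) (T.cellMap v) t w = 0) : w = 0 := by
  rw [← mfderivWithin_of_mem_nhds (openCorner_mem_nhds ht)] at hw
  exact mfderivWithin_cellMap_injective hs hv (openCorner_subset ht) hw

/-- The parametrization of a top-dimensional cell is an open map on the open simplex. -/
theorem isOpen_image_cellMap (hs : s ∈ T.K.faces) (hv : Enumerates v s)
    {O : Set (EuclideanSpace ℝ (Fin N))} (hO : IsOpen O) (hOc : O ⊆ openCorner N) :
    IsOpen (T.cellMap v '' O) := by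
  rw [isOpen_iff_mem_nhds]
  rintro _ ⟨t, ht, rfl⟩
  obtain ⟨G, hG1, hG2, hG3⟩ := exists_local_right_inverse
    (contMDiffAt_cellMap hs hv.mem (hOc ht)) (fun w => mfderiv_cellMap_injective hs hv (hOc ht))
  have h1 : ∀ᶠ y in nhds (T.cellMap v t), G y ∈ O :=
    hG2.continuousAt.eventually (by rw [hG1]; exact hO.mem_nhds ht)
  filter_upwards [h1, hG3] with y hy1 hy2
  exact ⟨G y, hy1, hy2⟩

/-- In the interior of a top-dimensional cell, the differentials of the barycentric coordinates are
constant with respect to the affine parametrization of the cell. -/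
theorem dmu_cellMap (hs : s ∈ T.K.faces) (hv : Enumerates v s)
    {t : EuclideanSpace ℝ (Fin N)} (ht : t ∈ openCorner N) (u : A)
    (w : EuclideanSpace ℝ (Fin N)) :
    dmu T u (T.cellMap v t)
      (mfderiv 𝓘(ℝ, EuclideanSpace ℝ (Fin N)) (𝓡 N) (T.cellMap v) t w) = faceLin v u w := by
  obtain ⟨G, hG1, hG2, hG3⟩ := exists_local_right_inverse
    (contMDiffAt_cellMap hs hv.mem ht) (fun w => mfderiv_cellMap_injective hs hv ht)
  have hf : MDifferentiableAt 𝓘(ℝ, EuclideanSpace ℝ (Fin N)) 𝓘(ℝ, ℝ) (faceCoord v u)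
      (G (T.cellMap v t)) := (hasFDerivAt_faceCoord v u _).differentiableAt.mdifferentiableAt
  have hmu : MDifferentiableAt (𝓡 N) 𝓘(ℝ, ℝ) (T.mu u) (T.cellMap v t) := by
    refine (hf.comp _ hG2).congr_of_eventuallyEq ?_
    have h1 : ∀ᶠ y in nhds (T.cellMap v t), G y ∈ corner N :=
      hG2.continuousAt.eventually (by rw [hG1]; exact openCorner_mem_nhds ht)
    filter_upwards [h1, hG3] with y hy1 hy2
    rw [Function.comp_apply, ← mu_cellMap hs hv.mem hy1, hy2]
  have hξ := (contMDiffAt_cellMap hs hv.mem ht).mdifferentiableAt (by simp)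
  have h2 : mfderiv 𝓘(ℝ, EuclideanSpace ℝ (Fin N)) 𝓘(ℝ, ℝ) (T.mu u ∘ T.cellMap v) t =
      faceLin v u := by
    have h3 : T.mu u ∘ T.cellMap v =ᶠ[nhds t] faceCoord v u := by
      filter_upwards [openCorner_mem_nhds ht] with y hy
      exact mu_cellMap hs hv.mem hy u
    rw [h3.mfderiv_eq]
    exact (hasFDerivAt_faceCoord v u t).hasMFDerivAt.mfderiv
  rw [mfderiv_comp t hmu hξ] at h2
  exact congrArg (fun L : EuclideanSpace ℝ (Fin N) →L[ℝ] ℝ => L w) h2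

end SmoothTriangulation

end CellMap

/-! ### Whitney forms on a top-dimensional cell -/

theorem alternatingMap_sum_apply {κ ι W V : Type*} [AddCommGroup W] [Module ℝ W] [AddCommGroup V]
    [Module ℝ V] (S : Finset κ) (f : κ → W [⋀^ι]→ₗ[ℝ] V) (w : ι → W) :
    (∑ k ∈ S, f k) w = ∑ k ∈ S, f k w := by
  classical
  induction S using Finset.induction_on with
  | empty => simp
  | insert k S hk ih => rw [Finset.sum_insert hk, Finset.sum_insert hk, AlternatingMap.add_apply, ih]

/-- A determinant whose first column sums to `1` and whose other columns are the differences
`e_{k+1} - e₀` of the standard basis vectors equals `1`: adding all rows to the first one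
turns that row into `(1, 0, …, 0)`. -/
theorem det_edge_matrix {q : ℕ} (x : Fin (q + 1) → ℝ) (hx : ∑ a, x a = 1) :
    Matrix.det (Matrix.of fun a : Fin (q + 1) => Fin.cons (x a) fun k : Fin q =>
      (if k.succ = a then (1 : ℝ) else 0) - if 0 = a then 1 else 0) = 1 := by
  set B : Matrix (Fin (q + 1)) (Fin (q + 1)) ℝ := Matrix.of fun a => Fin.cons (x a)
    fun k : Fin q => (if k.succ = a then (1 : ℝ) else 0) - if 0 = a then 1 else 0 with hB
  have h1 : (B.updateRow 0 (∑ a, B a)).det = B.det := by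
    have := Matrix.det_updateRow_sum B 0 (fun _ => (1 : ℝ))
    simpa using this
  have h2 : (∑ a, B a) = Pi.single 0 1 := by
    ext k
    have hk : (∑ a, B a) k = ∑ a, B a k := Finset.sum_apply k _ _
    rw [hk]
    cases k using Fin.cases with
    | zero => simpa [hB] using hx
    | succ k => simp [hB, Finset.sum_sub_distrib]
  rw [← h1, h2, Matrix.det_succ_row_zero, Fin.sum_univ_succ]
  simp only [Matrix.updateRow_self, Pi.single_eq_same, Fin.val_zero, pow_zero, one_mul,
    Fin.succAbove_zero]
  rw [Finset.sum_eq_zero (fun k _ => by simp), add_zero]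
  have h3 : (B.updateRow 0 (Pi.single 0 1)).submatrix Fin.succ Fin.succ = 1 := by
    ext a k
    simp [hB, Matrix.one_apply, eq_comm]
  rw [h3, Matrix.det_one]

section WhitneyCoord

variable {N : ℕ} {A : Type*}

/-- The value of the Whitney form of the simplex `o`, pulled back to the parameter domain of the
cell with vertices `v`, at the point `t` and on the vectors `w`. The sum defining the Whitney form
is the expansion of a determinant along its first column. -/
def whitneyCoord {q : ℕ} (v : Fin (N + 1) → A) (o : Fin (q + 1) → A)
    (t : EuclideanSpace ℝ (Fin N)) (w : Fin q → EuclideanSpace ℝ (Fin N)) : ℝ :=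
  q ! * Matrix.det (Matrix.of fun a : Fin (q + 1) =>
    (Fin.cons (faceCoord v (o a) t) fun k => faceLin v (o a) (w k) : Fin (q + 1) → ℝ))

theorem continuous_whitneyCoord {q : ℕ} (v : Fin (N + 1) → A) (o : Fin (q + 1) → A)
    (w : Fin q → EuclideanSpace ℝ (Fin N)) : Continuous fun t => whitneyCoord v o t w := by
  refine continuous_const.mul (Continuous.matrix_det (continuous_matrix fun a k => ?_))
  cases k using Fin.cases with
  | zero => exact continuous_faceCoord v (o a)
  | succ k => exact continuous_const

end WhitneyCoord

section Whitney

variable {N : ℕ} {M : Type*} [TopologicalSpace M] [ChartedSpace (EuclideanSpace ℝ (Fin N)) M]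
  {A : Type*} [NormedAddCommGroup A] [NormedSpace ℝ A]
  {T : SmoothTriangulation N M A} {s : Finset A} {v : Fin (N + 1) → A}

theorem whitneyForm_cellMap (hs : s ∈ T.K.faces) (hv : Enumerates v s) {q : ℕ}
    (o : Fin (q + 1) → A) {t : EuclideanSpace ℝ (Fin N)} (ht : t ∈ openCorner N)
    (w : Fin q → EuclideanSpace ℝ (Fin N)) :
    whitneyForm T o (T.cellMap v t) (fun k =>
      mfderiv 𝓘(ℝ, EuclideanSpace ℝ (Fin N)) (𝓡 N) (T.cellMap v) t (w k)) =
      whitneyCoord v o t w := by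
  have hw : ∀ i : Fin (q + 1), wedge (fun j : Fin q => dmu T (o (i.succAbove j)) (T.cellMap v t))
      (fun k => mfderiv 𝓘(ℝ, EuclideanSpace ℝ (Fin N)) (𝓡 N) (T.cellMap v) t (w k)) =
      Matrix.det (Matrix.of fun j k : Fin q => faceLin v (o (i.succAbove j)) (w k)) := by
    intro i
    rw [← Matrix.det_transpose]
    change Matrix.det _ = _
    congr 1
    ext k j
    exact SmoothTriangulation.dmu_cellMap hs hv ht _ _
  rw [whitneyCoord, Matrix.det_succ_column_zero]
  simp only [whitneyForm, AlternatingMap.smul_apply, smul_eq_mul]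
  rw [alternatingMap_sum_apply]
  congr 1
  refine Finset.sum_congr rfl fun i _ => ?_
  rw [AlternatingMap.smul_apply, hw, SmoothTriangulation.mu_cellMap hs hv.mem (openCorner_subset ht)]
  rfl

theorem whitneyMap_cellMap (hs : s ∈ T.K.faces) (hv : Enumerates v s) (m : T.Marking) {q : ℕ}
    {V : Type*} [AddCommGroup V] [Module ℝ V] (c : T.Simplex q → V)
    {t : EuclideanSpace ℝ (Fin N)} (ht : t ∈ openCorner N)
    (w : Fin q → EuclideanSpace ℝ (Fin N)) :
    whitneyMap T m c (T.cellMap v t) (fun k =>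
      mfderiv 𝓘(ℝ, EuclideanSpace ℝ (Fin N)) (𝓡 N) (T.cellMap v) t (w k)) =
      ∑ σ : T.Simplex q, whitneyCoord v (fun i => (m.order σ i : A)) t w • c σ := by
  rw [whitneyMap, alternatingMap_sum_apply]
  refine Finset.sum_congr rfl fun σ _ => ?_
  rw [← whitneyForm_cellMap hs hv _ ht w]
  rfl

/-- Duality between Whitney forms and simplices: at a point of the simplex `σ`, and on the edge
vectors of `σ`, the Whitney form of `σ` is `q!` and the other Whitney forms vanish. -/
theorem whitneyCoord_edges (hv : Enumerates v s) (m : T.Marking) {q : ℕ}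
    {σ : T.Simplex q} {r : Fin (q + 1) → Fin (N + 1)} (hr : ∀ a, v (r a) = m.order σ a)
    {t : EuclideanSpace ℝ (Fin N)} (ht : ∀ i, v i ∉ σ.1 → cornerCoord i t = 0)
    (σ' : T.Simplex q) [Decidable (σ' = σ)] :
    whitneyCoord v (fun i => (m.order σ' i : A)) t (fun k =>
      cornerPoint (Pi.single (r k.succ) 1) - cornerPoint (Pi.single (r 0) 1)) =
      if σ' = σ then (q ! : ℝ) else 0 := by
  classical
  have hri : Function.Injective r := fun a b h =>
    (m.order σ).injective (Subtype.ext (by rw [← hr, ← hr, h]))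
  have hlin : ∀ u i j, faceLin v u (cornerPoint (Pi.single i 1) - cornerPoint (Pi.single j 1)) =
      (if v i = u then (1 : ℝ) else 0) - if v j = u then 1 else 0 := by
    intro u i j
    simp only [faceLin, sum_apply]
    have : ∀ k, (if v k = u then cornerLin k else 0 : EuclideanSpace ℝ (Fin N) →L[ℝ] ℝ)
        (cornerPoint (Pi.single i 1) - cornerPoint (Pi.single j 1)) =
        (if i = k then (if v i = u then (1 : ℝ) else 0) else 0) -
          if j = k then (if v j = u then 1 else 0) else 0 := by
      intro k
      by_cases hk : v k = u
      · rw [if_pos hk, cornerLin_sub]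
        congr 1
        · split_ifs with h1 h2
          · rfl
          · exact absurd (h1 ▸ hk) h2
          · rfl
        · split_ifs with h1 h2
          · rfl
          · exact absurd (h1 ▸ hk) h2
          · rfl
      · rw [if_neg hk]
        have h1 : i = k → ¬ v i = u := fun h => h ▸ hk
        have h2 : j = k → ¬ v j = u := fun h => h ▸ hk
        have e1 : (if i = k then (if v i = u then (1 : ℝ) else 0) else 0) = 0 := by
          split_ifs with h h'
          · exact absurd h' (h1 h)
          · rfl
          · rfl
        have e2 : (if j = k then (if v j = u then (1 : ℝ) else 0) else 0) = 0 := by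
          split_ifs with h h'
          · exact absurd h' (h2 h)
          · rfl
          · rfl
        rw [e1, e2]
        simp
    simp only [this, Finset.sum_sub_distrib]
    simp
  rw [whitneyCoord]
  by_cases h : σ' = σ
  · subst h
    rw [if_pos rfl]
    have hsum : ∑ a, faceCoord v (m.order σ' a : A) t = 1 := by
      rw [← sum_cornerCoord t]
      simp only [← hr, faceCoord_apply hv.injective]
      have h1 : ∑ a, cornerCoord (r a) t = ∑ i ∈ Finset.univ.image r, cornerCoord i t :=
        (Finset.sum_image (g := r) (f := fun i => cornerCoord i t)
          fun _ _ _ _ h => hri h).symm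
      rw [h1]
      refine Finset.sum_subset (Finset.subset_univ _) fun i _ hi => ht i fun hσ => hi ?_
      obtain ⟨a, ha⟩ := (m.order σ').surjective ⟨v i, hσ⟩
      refine Finset.mem_image.2 ⟨a, Finset.mem_univ _, hv.injective ?_⟩
      rw [hr, ha]
    have hdet := det_edge_matrix _ hsum
    refine Eq.trans (congrArg (fun B : Matrix (Fin (q + 1)) (Fin (q + 1)) ℝ =>
      (q ! : ℝ) * B.det) ?_) ((congrArg (fun r : ℝ => (q ! : ℝ) * r) hdet).trans (mul_one _))
    ext a k
    cases k using Fin.cases with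
    | zero => simp
    | succ k =>
      have e1 : ∀ b, (v (r b) = (m.order σ' a : A)) ↔ b = a := fun b => by
        rw [← hr, hv.injective.eq_iff, hri.eq_iff]
      simp [hlin, e1]
  · rw [if_neg h]
    -- some vertex of `σ'` is not in `σ`; the row of that vertex vanishes
    have hex : ∃ a, (m.order σ' a : A) ∉ σ.1 := by
      by_contra! hall
      refine h (Subtype.ext (Finset.eq_of_subset_of_card_le (fun u hu => ?_) ?_))
      · have := hall ((m.order σ').symm ⟨u, hu⟩)
        simpa using this
      · rw [σ.2.2, σ'.2.2]
    obtain ⟨a, ha⟩ := hex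
    rw [Matrix.det_eq_zero_of_row_eq_zero a, mul_zero]
    intro k
    cases k using Fin.cases with
    | zero =>
      simp only [Matrix.of_apply, Fin.cons_zero]
      refine Finset.sum_eq_zero fun i _ => ?_
      split_ifs with hi
      · exact ht i (hi ▸ ha)
      · rfl
    | succ k =>
      have e1 : ∀ b, v (r b) ≠ (m.order σ' a : A) := fun b hb => ha (by
        rw [← hb, hr]; exact (m.order σ b).2)
      simp [hlin, e1]

end Whitney

/-! ### Recovering a cochain from its Whitney form -/

section FaceValue

variable {N : ℕ} {M : Type*} [TopologicalSpace M] [ChartedSpace (EuclideanSpace ℝ (Fin N)) M]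
  {A : Type*} [NormedAddCommGroup A] [NormedSpace ℝ A]
  {T : SmoothTriangulation N M A} {s : Finset A} {v : Fin (N + 1) → A}

/-- A dense set of points of `M` is dense in the parameter domain of a top-dimensional cell. -/
theorem SmoothTriangulation.corner_subset_closure_preimage (hs : s ∈ T.K.faces)
    (hv : Enumerates v s) {S : Set M} (hS : Dense S) :
    corner N ⊆ closure (openCorner N ∩ T.cellMap v ⁻¹' S) := by
  refine corner_subset_closure_openCorner.trans (closure_minimal ?_ isClosed_closure)
  intro t ht
  rw [mem_closure_iff]
  intro O hO htO
  have hopen : IsOpen (T.cellMap v '' (O ∩ openCorner N)) :=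
    isOpen_image_cellMap hs hv (hO.inter isOpen_openCorner) Set.inter_subset_right
  obtain ⟨_, ⟨z, hz, rfl⟩, hzS⟩ := hS.inter_open_nonempty _ hopen ⟨_, t, ⟨htO, ht⟩, rfl⟩
  exact ⟨z, hz.1, hz.2, hzS⟩

theorem mu_eq_zero_of_mem_cell {σ : Finset A} (hσ : σ ∈ T.K.faces) {a : A}
    (ha : a ∈ convexHull ℝ (σ : Set A)) {u : A} (hu : u ∉ σ) : T.mu u (T.map a) = 0 := by
  rw [SmoothTriangulation.mu, T.inv_map a (T.K.convexHull_subset_space hσ ha),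
    bary_eq_zero_of_notMem hσ ha hu]

variable {F : Type*} [NormedAddCommGroup F] [NormedSpace ℂ F]
  {E : M → Type*} [TopologicalSpace (TotalSpace F E)]
  [∀ x, NormedAddCommGroup (E x)] [∀ x, InnerProductSpace ℂ (E x)]
  [FiberBundle F E] [VectorBundle ℂ F E] [∀ x, FiniteDimensional ℂ (E x)]
  {T₀ : SmoothTriangulation N M A} {ι : Type*} [Fintype ι]

/-- If `i^* W b` vanishes on a dense set, then `i^*` kills the value of the cochain `b` on every
simplex `σ` lying in a top-dimensional one: evaluate `i^* W b` on the edge vectors of `σ`, at points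
of the open top-dimensional cell tending to the reference point of `σ`. -/
theorem adjoint_apply_eq_zero_of_dense (D : EmbeddingData T₀ F E ι) (hs : s ∈ T.K.faces)
    (hv : Enumerates v s) (m : T.Marking) {q : ℕ} (b : T.Simplex q → D.V)
    (hb : Dense {x | ∀ w, LinearMap.adjoint (D.i x) (whitneyMap T m b x w) = 0})
    {σ : T.Simplex q} (hσ : σ.1 ⊆ s) :
    LinearMap.adjoint (D.i (m.refPoint σ)) (b σ) = 0 := by
  classical
  obtain ⟨a, ha, hap⟩ := m.refPoint_mem σ
  replace ha := intrinsicInterior_subset ha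
  obtain ⟨t₀, ht₀, hta⟩ := hv.exists_simplexMap_eq (convexHull_mono (by exact_mod_cast hσ) ha)
  have hp : T.cellMap v t₀ = m.refPoint σ := by
    rw [SmoothTriangulation.cellMap, hta, hap]
  have hzero : ∀ i, v i ∉ σ.1 → cornerCoord i t₀ = 0 := by
    intro i hi
    rw [← faceCoord_apply hv.injective, ← SmoothTriangulation.mu_cellMap hs hv.mem ht₀, hp, ← hap]
    exact mu_eq_zero_of_mem_cell σ.2.1 ha hi
  choose r hr using fun k => hv.exists_eq (m.order σ k) (hσ (m.order σ k).2)
  -- the edge vectors of `σ`, in the parameter domain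
  set w : Fin q → EuclideanSpace ℝ (Fin N) := fun k =>
    cornerPoint (Pi.single (r k.succ) 1) - cornerPoint (Pi.single (r 0) 1) with hw
  set e := trivializationAt F E (m.refPoint σ) with he
  have hpe : m.refPoint σ ∈ e.baseSet := FiberBundle.mem_baseSet_trivializationAt' _
  set β : EuclideanSpace ℝ (Fin N) → D.V := fun t =>
    ∑ σ' : T.Simplex q, whitneyCoord v (fun i => (m.order σ' i : A)) t w • b σ' with hβ
  have hβc : Continuous β := continuous_finsetSum _ fun σ' _ =>
    (continuous_whitneyCoord v _ w).smul continuous_const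
  have hβ₀ : β t₀ = (q ! : ℝ) • b σ := by
    simp only [hβ, hw, whitneyCoord_edges hv m hr hzero, ite_smul, zero_smul]
    simp
  -- the adjoint need not be known to be continuous: pair with sections constant in a trivialization
  have key : ∀ f : F, (inner ℂ (D.i (m.refPoint σ) (e.symm (m.refPoint σ) f)) (β t₀) : ℂ) = 0 := by
    intro f
    set S := openCorner N ∩ T.cellMap v ⁻¹'
      {x | ∀ w, LinearMap.adjoint (D.i x) (whitneyMap T m b x w) = 0} with hS
    have : (nhdsWithin t₀ S).NeBot := mem_closure_iff_nhdsWithin_neBot.1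
      (SmoothTriangulation.corner_subset_closure_preimage hs hv hb ht₀)
    have hξ : ContinuousWithinAt (T.cellMap v) S t₀ :=
      ((SmoothTriangulation.contMDiffOn_cellMap hs hv.mem).continuousOn t₀ ht₀).mono
        (Set.inter_subset_left.trans openCorner_subset)
    have hi : ContinuousAt (fun x => D.i x (e.symm x f)) (T.cellMap v t₀) := by
      rw [hp]
      exact (D.continuousOn_i_symm (m.refPoint σ) f).continuousAt (e.open_baseSet.mem_nhds hpe)
    have hcomp : ContinuousWithinAt
        (fun t => D.i (T.cellMap v t) (e.symm (T.cellMap v t) f)) S t₀ :=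
      ContinuousAt.comp_continuousWithinAt (g := fun x => D.i x (e.symm x f)) hi hξ
    have hlim : Filter.Tendsto (fun t => (inner ℂ (D.i (T.cellMap v t) (e.symm (T.cellMap v t) f))
        (β t) : ℂ)) (nhdsWithin t₀ S)
        (nhds (inner ℂ (D.i (T.cellMap v t₀) (e.symm (T.cellMap v t₀) f)) (β t₀))) :=
      hcomp.inner hβc.continuousWithinAt
    have hlim0 : Filter.Tendsto (fun t => (inner ℂ (D.i (T.cellMap v t)
        (e.symm (T.cellMap v t) f)) (β t) : ℂ)) (nhdsWithin t₀ S) (nhds 0) := by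
      refine tendsto_const_nhds.congr' ?_
      filter_upwards [self_mem_nhdsWithin] with t ht
      have h1 := ht.2 (fun k => mfderiv 𝓘(ℝ, EuclideanSpace ℝ (Fin N)) (𝓡 N) (T.cellMap v) t (w k))
      rw [whitneyMap_cellMap hs hv m b ht.1 w] at h1
      rw [← LinearMap.adjoint_inner_right, h1, inner_zero_right]
    rw [← hp]
    exact tendsto_nhds_unique hlim hlim0
  refine ext_inner_left ℂ fun y => ?_
  have h1 := key (e.linearEquivAt ℂ _ hpe y)
  have h2 : e.symm (m.refPoint σ) (e.linearEquivAt ℂ _ hpe y) = y :=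
    (e.linearEquivAt ℂ _ hpe).symm_apply_apply y
  rw [h2, hβ₀, RCLike.real_smul_eq_coe_smul (K := ℂ), inner_smul_right] at h1
  rw [inner_zero_right, LinearMap.adjoint_inner_right]
  exact (mul_eq_zero.1 h1).resolve_left (by exact_mod_cast q.factorial_ne_zero)

end FaceValue

section MeanEmbedding

theorem mean_apply {κ : Type*} [Fintype κ] {n : ℕ} (g : κ → EuclideanSpace ℂ (Fin n)) (p : Fin n) :
    mean g p = mean fun k => g k p := by
  simp [mean]

theorem mean_ofReal {κ : Type*} [Fintype κ] (g : κ → ℝ) :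
    (mean fun k => (g k : ℂ)) = ((mean g : ℝ) : ℂ) := by
  simp [mean]

variable {N : ℕ} {M : Type*} [EMetricSpace M] [ChartedSpace (EuclideanSpace ℝ (Fin N)) M]
  {A : Type*} [NormedAddCommGroup A] [NormedSpace ℝ A]
  {T : SmoothTriangulation N M A}

theorem sum_vertex {V : Type*} [AddCommMonoid V] {S : Finset A} (hS : S ∈ T.K.faces) (g : A → V)
    [∀ u : T.Vertex, Decidable (u.1 ∈ S)] :
    ∑ u : T.Vertex, (if u.1 ∈ S then g u.1 else 0) = ∑ u : {u // u ∈ S}, g u := by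
  rw [← Finset.sum_filter]
  refine Finset.sum_bij' (fun u hu => ⟨u.1, (Finset.mem_filter.1 hu).2⟩)
    (fun u _ => ⟨u.1, T.K.down_closed hS (Finset.singleton_subset_iff.2 u.2)
      (Finset.singleton_nonempty _)⟩) ?_ ?_ ?_ ?_ ?_
  · exact fun u hu => Finset.mem_univ _
  · exact fun u hu => Finset.mem_filter.2 ⟨Finset.mem_univ _, u.2⟩
  · exact fun u hu => rfl
  · exact fun u hu => rfl
  · exact fun u hu => rfl

/-- The cup product with a function multiplies a cochain by the mean of the function over the
vertices of the simplex. -/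
theorem cupZero_apply {q : ℕ} (g : M → ℂ) (c : T.Simplex q → ℂ) (σ : T.Simplex q) :
    T.cupZero (T.deRhamZero g) c σ = (mean fun u : {u // u ∈ σ.1} => g (T.map u)) * c σ := by
  classical
  have hcard : Fintype.card {u // u ∈ σ.1} = q + 1 :=
    (Fintype.card_coe σ.1).trans σ.2.2
  have hcoef : ((0 ! * q ! : ℂ) / ((0 + q + 1) ! : ℂ)) = ((q : ℂ) + 1)⁻¹ := by
    have h2 : ((q ! : ℕ) : ℂ) ≠ 0 := by exact_mod_cast q.factorial_ne_zero
    have h3 : (q : ℂ) + 1 ≠ 0 := by exact_mod_cast q.succ_ne_zero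
    rw [zero_add, Nat.factorial_succ]
    push_cast
    field_simp
    simp
  unfold SmoothTriangulation.cupZero SmoothTriangulation.deRhamZero
  rw [hcoef, sum_vertex σ.2.1 (fun u => ((q : ℂ) + 1)⁻¹ * g (T.map u) * c σ), ← Finset.sum_mul,
    ← Finset.mul_sum, mean, hcard, RCLike.real_smul_eq_coe_mul (K := ℂ)]
  push_cast
  rfl

variable {F : Type*} [NormedAddCommGroup F] [NormedSpace ℂ F]
  {E : M → Type*} [TopologicalSpace (TotalSpace F E)]
  [∀ x, NormedAddCommGroup (E x)] [∀ x, InnerProductSpace ℂ (E x)]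
  [FiberBundle F E]
  {T₀ : SmoothTriangulation N M A} {ι : Type*} [Fintype ι]

theorem EmbeddingData.meanEmbedding_apply_of_subset (D : EmbeddingData T₀ F E ι) {κ : Type*}
    [Fintype κ] {S : Set M} (y : κ → M) {x : M} (u : E x) {l : ι} (h : S ⊆ closure (D.U l))
    (p : Fin (D.n l)) :
    D.meanEmbedding S y u l p = ∑ s, (mean fun k => D.entry l p s (y k)) *
      ((mean fun k => (D.ψ l (y k) : ℂ)) * (D.frame l x).repr u s) := by
  simp only [meanEmbedding, if_pos h]
  rw [PiLp.smul_apply, WithLp.ofLp_sum, Finset.sum_apply, RCLike.real_smul_eq_coe_mul (K := ℂ),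
    Finset.mul_sum]
  refine Finset.sum_congr rfl fun s _ => ?_
  rw [PiLp.smul_apply, mean_apply, mean_ofReal, smul_eq_mul]
  simp only [entry]
  change ((mean fun k => D.ψ l (y k) : ℝ) : ℂ) * _ = _
  ring

/-- The value of `I c` on `σ` is the mean embedding of `c σ`, taken over the vertices of `σ`. -/
theorem twistI_apply (D : EmbeddingData T₀ F E ι) {m : T.Marking} {q : ℕ}
    (c : TwistedCochain m E q) (σ : T.Simplex q) :
    twistI D c σ = D.meanEmbedding (T.cell σ.1) (fun u : {u // u ∈ σ.1} => T.map u) (c σ) := by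
  ext l p
  by_cases h : T.cell σ.1 ⊆ closure (D.U l)
  · refine Eq.trans ?_ (D.meanEmbedding_apply_of_subset _ _ h p).symm
    refine (if_pos h).trans (Finset.sum_apply σ _ _ |>.trans (Finset.sum_congr rfl fun s _ => ?_))
    exact (cupZero_apply _ _ σ).trans (congrArg _ (cupZero_apply _ _ σ))
  · simp only [twistI, EmbeddingData.meanEmbedding, if_neg h]
    rfl

end MeanEmbedding

/-! ### Null sets and finiteness of the Riemannian volume -/

section Volume

variable {N : ℕ} {M : Type*} [TopologicalSpace M] [ChartedSpace (EuclideanSpace ℝ (Fin N)) M]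
  [RiemannianBundle (fun x : M => TangentSpace (𝓡 N) x)]

/-- The Gram matrix of an injective linear image of a basis of `ℝ^N` is positive definite. -/
theorem det_gram_pos {x : M} (L : EuclideanSpace ℝ (Fin N) →ₗ[ℝ] TangentSpace (𝓡 N) x)
    (hL : Function.Injective L) :
    0 < (Matrix.gram ℝ fun i : Fin N => L (EuclideanSpace.single i (1 : ℝ))).det := by
  refine (Matrix.posDef_gram_of_linearIndependent ?_).det_pos
  have h : LinearIndependent ℝ fun i : Fin N => L (EuclideanSpace.single i (1 : ℝ)) := by
    have h1 := (EuclideanSpace.basisFun (Fin N) ℝ).toBasis.linearIndependent.map' L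
      (LinearMap.ker_eq_bot.2 hL)
    have h2 : (L ∘ (EuclideanSpace.basisFun (Fin N) ℝ).toBasis) =
        fun i : Fin N => L (EuclideanSpace.single i (1 : ℝ)) := by
      funext i
      simp
    rwa [h2] at h1
  exact h

theorem volumeDensity_pos [IsManifold (𝓡 N) ∞ M] (x₀ : M) {z : EuclideanSpace ℝ (Fin N)}
    (hz : z ∈ (chartAt (EuclideanSpace ℝ (Fin N)) x₀).target) : 0 < volumeDensity x₀ z := by
  have : IsManifold (𝓡 N) 1 M := IsManifold.of_le (n := ∞) (by simp)
  refine Real.sqrt_pos.2 ?_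
  exact det_gram_pos (mfderiv 𝓘(ℝ, EuclideanSpace ℝ (Fin N)) (𝓡 N)
    (chartAt (EuclideanSpace ℝ (Fin N)) x₀).symm z).toLinearMap
    ((mdifferentiable_chart (I := 𝓡 N) x₀).symm.mfderiv_injective hz)

variable [MeasurableSpace M]

/-- The Riemannian volume is absolutely continuous with respect to the volumes of the charts. -/
theorem riemannianVolume_eq_zero [IsManifold (𝓡 N) ∞ M] [T2Space M] [SigmaCompactSpace M]
    {S : Set M} (hS : MeasurableSet S) (h : ∀ x₀ : M, chartVolume (N := N) x₀ S = 0) :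
    riemannianVolume N M S = 0 := by
  rw [riemannianVolume, Measure.sum_apply _ hS, ENNReal.tsum_eq_zero]
  exact fun x₀ => withDensity_absolutelyContinuous _ _ (h x₀)

theorem aemeasurable_chart_symm [BorelSpace M] (x₀ : M) :
    AEMeasurable (chartAt (EuclideanSpace ℝ (Fin N)) x₀).symm
      ((volume.restrict (chartAt (EuclideanSpace ℝ (Fin N)) x₀).target).withDensity
        fun z => ENNReal.ofReal (volumeDensity (N := N) x₀ z)) :=
  AEMeasurable.mono_ac
    ((chartAt (EuclideanSpace ℝ (Fin N)) x₀).continuousOn_symm.aemeasurable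
      (chartAt (EuclideanSpace ℝ (Fin N)) x₀).open_target.measurableSet)
    (withDensity_absolutelyContinuous _ _)

end Volume

section TangentMap

variable {N : ℕ} {M : Type*} [TopologicalSpace M] [ChartedSpace (EuclideanSpace ℝ (Fin N)) M]
  [IsManifold (𝓡 N) ∞ M]

theorem continuousOn_mfderivWithin_apply {f : EuclideanSpace ℝ (Fin N) → M}
    {s : Set (EuclideanSpace ℝ (Fin N))}
    (hf : ContMDiffOn 𝓘(ℝ, EuclideanSpace ℝ (Fin N)) (𝓡 N) ∞ f s)
    (hs : UniqueMDiffOn 𝓘(ℝ, EuclideanSpace ℝ (Fin N)) s) (w : EuclideanSpace ℝ (Fin N)) :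
    ContinuousOn (fun z => (⟨f z, mfderivWithin 𝓘(ℝ, EuclideanSpace ℝ (Fin N)) (𝓡 N) f s z w⟩ :
      TangentBundle (𝓡 N) M)) s := by
  have : IsManifold (𝓡 N) 1 M := IsManifold.of_le (n := ∞) (by simp)
  have h1 := hf.continuousOn_tangentMapWithin (by simp) hs
  have h2 : Continuous fun z : EuclideanSpace ℝ (Fin N) =>
      (⟨z, w⟩ : TangentBundle 𝓘(ℝ, EuclideanSpace ℝ (Fin N)) (EuclideanSpace ℝ (Fin N))) :=
    (tangentBundleModelSpaceHomeomorph 𝓘(ℝ, EuclideanSpace ℝ (Fin N))).symm.continuous.comp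
      (continuous_id.prodMk continuous_const)
  exact h1.comp h2.continuousOn fun z hz => hz

variable [RiemannianBundle (fun x : M => TangentSpace (𝓡 N) x)]
  [IsContMDiffRiemannianBundle (𝓡 N) ∞ (EuclideanSpace ℝ (Fin N))
    (fun x : M => TangentSpace (𝓡 N) x)]

theorem isContinuousRiemannianBundle_tangentSpace :
    IsContinuousRiemannianBundle (EuclideanSpace ℝ (Fin N)) (fun x : M => TangentSpace (𝓡 N) x) := by
  obtain ⟨g, hg, h⟩ := IsContMDiffRiemannianBundle.exists_contMDiff (IB := 𝓡 N) (n := ∞)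
    (F := EuclideanSpace ℝ (Fin N)) (E := fun x : M => TangentSpace (𝓡 N) x)
  exact ⟨g, hg.continuous, h⟩

/-- The metric coefficients of a smooth parametrization are continuous. -/
theorem continuousOn_inner_mfderivWithin {f : EuclideanSpace ℝ (Fin N) → M}
    {s : Set (EuclideanSpace ℝ (Fin N))}
    (hf : ContMDiffOn 𝓘(ℝ, EuclideanSpace ℝ (Fin N)) (𝓡 N) ∞ f s)
    (hs : UniqueMDiffOn 𝓘(ℝ, EuclideanSpace ℝ (Fin N)) s) (w w' : EuclideanSpace ℝ (Fin N)) :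
    ContinuousOn (fun z =>
      (inner ℝ (mfderivWithin 𝓘(ℝ, EuclideanSpace ℝ (Fin N)) (𝓡 N) f s z w)
        (mfderivWithin 𝓘(ℝ, EuclideanSpace ℝ (Fin N)) (𝓡 N) f s z w') : ℝ)) s :=
  have := isContinuousRiemannianBundle_tangentSpace (N := N) (M := M)
  ContinuousOn.inner_bundle (F := EuclideanSpace ℝ (Fin N))
    (E := fun x : M => TangentSpace (𝓡 N) x) (b := f)
    (continuousOn_mfderivWithin_apply hf hs w) (continuousOn_mfderivWithin_apply hf hs w')

theorem continuousOn_coordVector_inner (x₀ : M) (i j : Fin N) :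
    ContinuousOn (fun z => (inner ℝ (coordVector x₀ z i) (coordVector x₀ z j) : ℝ))
      (chartAt (EuclideanSpace ℝ (Fin N)) x₀).target := by
  set χ := chartAt (EuclideanSpace ℝ (Fin N)) x₀ with hχ
  have h := continuousOn_inner_mfderivWithin (f := χ.symm) (s := χ.target)
    (contMDiffOn_chart_symm (x := x₀)) χ.open_target.uniqueMDiffOn
    (EuclideanSpace.single i (1 : ℝ)) (EuclideanSpace.single j (1 : ℝ))
  refine h.congr fun z hz => ?_
  simp only [coordVector]
  rw [mfderivWithin_of_isOpen χ.open_target hz]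

theorem continuousOn_volumeDensity (x₀ : M) :
    ContinuousOn (volumeDensity (N := N) x₀) (chartAt (EuclideanSpace ℝ (Fin N)) x₀).target := by
  refine Real.continuous_sqrt.comp_continuousOn ?_
  refine continuousOn_iff_continuous_domRestrict.2 (Continuous.matrix_det
    (continuous_matrix fun i j => ?_))
  exact continuousOn_iff_continuous_domRestrict.1 (continuousOn_coordVector_inner x₀ i j)

variable [MeasurableSpace M] [BorelSpace M]

/-- The volume measure of a chart has the same null sets as Lebesgue measure. -/
theorem chartVolume_eq_zero_iff (x₀ : M) {S : Set M} (hS : MeasurableSet S) :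
    chartVolume (N := N) x₀ S = 0 ↔
      volume ((chartAt (EuclideanSpace ℝ (Fin N)) x₀).target ∩
        (chartAt (EuclideanSpace ℝ (Fin N)) x₀).symm ⁻¹' S) = 0 := by
  set χ := chartAt (EuclideanSpace ℝ (Fin N)) x₀ with hχ
  have hd : AEMeasurable (fun z => ENNReal.ofReal (volumeDensity (N := N) x₀ z))
      (volume.restrict χ.target) :=
    ENNReal.measurable_ofReal.comp_aemeasurable
      ((continuousOn_volumeDensity x₀).aemeasurable χ.open_target.measurableSet)
  rw [chartVolume, Measure.map_apply_of_aemeasurable (aemeasurable_chart_symm x₀) hS,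
    withDensity_apply_eq_zero' hd, Measure.restrict_apply' χ.open_target.measurableSet]
  have h : {z | ENNReal.ofReal (volumeDensity (N := N) x₀ z) ≠ 0} ∩ χ.symm ⁻¹' S ∩ χ.target =
      χ.target ∩ χ.symm ⁻¹' S := by
    ext z
    constructor
    · exact fun hz => ⟨hz.2, hz.1.2⟩
    · exact fun hz => ⟨⟨(ENNReal.ofReal_pos.2 (volumeDensity_pos x₀ hz.1)).ne', hz.2⟩, hz.1⟩
  exact Iff.of_eq (congrArg (fun S => volume S = 0) h)

theorem chartVolume_lt_top [T2Space M] (x₀ : M) {K : Set M} (hK : IsCompact K)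
    (hKs : K ⊆ (chartAt (EuclideanSpace ℝ (Fin N)) x₀).source) :
    chartVolume (N := N) x₀ K < ⊤ := by
  set χ := chartAt (EuclideanSpace ℝ (Fin N)) x₀ with hχ
  have hc : IsCompact (χ '' K) := hK.image_of_continuousOn (χ.continuousOn.mono hKs)
  have hct : χ '' K ⊆ χ.target := by
    rintro _ ⟨x, hx, rfl⟩
    exact χ.map_source (hKs hx)
  have hpre : χ.symm ⁻¹' K ∩ χ.target = χ '' K := by
    ext z
    constructor
    · exact fun hz => ⟨χ.symm z, hz.1, χ.right_inv hz.2⟩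
    · rintro ⟨x, hx, rfl⟩
      exact ⟨by simpa [χ.left_inv (hKs hx)] using hx, χ.map_source (hKs hx)⟩
  obtain ⟨C, hC⟩ := hc.bddAbove_image ((continuousOn_volumeDensity x₀).mono hct)
  rw [chartVolume, Measure.map_apply_of_aemeasurable (aemeasurable_chart_symm x₀) hK.measurableSet,
    withDensity_apply' _, Measure.restrict_restrict' χ.open_target.measurableSet]
  change ∫⁻ z in χ.symm ⁻¹' K ∩ χ.target, _ < ⊤
  rw [hpre]
  calc _ ≤ ∫⁻ _z in χ '' K, ENNReal.ofReal C :=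
        setLIntegral_mono measurable_const fun z hz =>
          ENNReal.ofReal_le_ofReal (hC (Set.mem_image_of_mem _ hz))
    _ < ⊤ := by
        rw [setLIntegral_const]
        exact ENNReal.mul_lt_top ENNReal.ofReal_lt_top hc.measure_lt_top

variable [T2Space M]

/-- The Riemannian volume is positive on nonempty open sets. -/
theorem dense_of_ae_riemannianVolume [SigmaCompactSpace M] {P : M → Prop}
    (h : ∀ᵐ x ∂riemannianVolume N M, P x) : Dense {x | P x} := by
  rw [dense_iff_inter_open]
  rintro O hO ⟨x, hx⟩
  by_contra hne
  have hO0 : riemannianVolume N M O = 0 := by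
    refine measure_mono_null (fun y hy hPy => hne ⟨y, hy, hPy⟩) h
  rw [riemannianVolume, Measure.sum_apply _ hO.measurableSet, ENNReal.tsum_eq_zero] at hO0
  set ρ := (SmoothPartitionOfUnity.exists_isSubordinate_chartAt_source (𝓡 N) M).choose with hρ
  have hsub := (SmoothPartitionOfUnity.exists_isSubordinate_chartAt_source (𝓡 N) M).choose_spec
  obtain ⟨x₀, hx₀⟩ := ρ.exists_pos_of_mem (Set.mem_univ x)
  have h1 := (withDensity_apply_eq_zero (ENNReal.measurable_ofReal.comp
    (ρ x₀).contMDiff.continuous.measurable)).1 (hO0 x₀)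
  change chartVolume x₀ ({x | ENNReal.ofReal (ρ x₀ x) ≠ 0} ∩ O) = 0 at h1
  set O' := {x | ENNReal.ofReal (ρ x₀ x) ≠ 0} ∩ O with hO'
  have hO'o : IsOpen O' :=
    (isOpen_ne_fun (ENNReal.continuous_ofReal.comp (ρ x₀).contMDiff.continuous)
      continuous_const).inter hO
  rw [chartVolume_eq_zero_iff x₀ hO'o.measurableSet] at h1
  set χ := chartAt (EuclideanSpace ℝ (Fin N)) x₀ with hχ
  have hxs : x ∈ χ.source := hsub x₀ (subset_tsupport _ hx₀.ne')
  have hopen : IsOpen (χ.target ∩ χ.symm ⁻¹' O') := χ.isOpen_inter_preimage_symm hO'o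
  refine (hopen.measure_pos volume ⟨χ x, χ.map_source hxs, ?_⟩).ne' h1
  rw [Set.mem_preimage, χ.left_inv hxs]
  exact ⟨(ENNReal.ofReal_pos.2 hx₀).ne', hx⟩

/-- The Riemannian volume of a closed manifold is finite. -/
theorem isFiniteMeasure_riemannianVolume [CompactSpace M] :
    IsFiniteMeasure (riemannianVolume N M) := by
  constructor
  rw [riemannianVolume, Measure.sum_apply _ MeasurableSet.univ]
  set ρ := (SmoothPartitionOfUnity.exists_isSubordinate_chartAt_source (𝓡 N) M).choose with hρ
  have hsub := (SmoothPartitionOfUnity.exists_isSubordinate_chartAt_source (𝓡 N) M).choose_spec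
  have hfin : {k | (Function.support (ρ k)).Nonempty}.Finite :=
    ρ.locallyFinite.finite_nonempty_of_compact
  have hzero : ∀ k ∉ hfin.toFinset, ((chartVolume (N := N) k).withDensity fun x =>
      ENNReal.ofReal (ρ k x)) Set.univ = 0 := by
    intro k hk
    have h0 : ∀ x, ρ k x = 0 := by
      by_contra! hne
      obtain ⟨x, hx⟩ := hne
      exact hk (hfin.mem_toFinset.2 ⟨x, hx⟩)
    simp [h0]
  rw [tsum_eq_sum hzero]
  refine ENNReal.sum_lt_top.2 fun k _ => ?_
  rw [withDensity_apply _ MeasurableSet.univ, Measure.restrict_univ]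
  calc _ ≤ ∫⁻ x, (tsupport (ρ k)).indicator (fun _ => 1) x ∂chartVolume (N := N) k := by
        refine lintegral_mono fun x => ?_
        by_cases hx : x ∈ tsupport (ρ k)
        · rw [Set.indicator_of_mem hx]
          exact ENNReal.ofReal_le_one.2 (ρ.le_one k x)
        · rw [Set.indicator_of_notMem hx]
          simp [image_eq_zero_of_notMem_tsupport hx]
    _ = chartVolume (N := N) k (tsupport (ρ k)) := by
        rw [lintegral_indicator (isClosed_tsupport _).measurableSet]
        simp
    _ < ⊤ := chartVolume_lt_top k (isClosed_tsupport _).isCompact (hsub k)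

end TangentMap

/-! ### The interiors of the top-dimensional cells have full measure -/

/-- A point of the relative interior of a simplex has positive barycentric coordinates, so every
simplex of the complex containing it contains the whole simplex. -/
theorem subset_of_mem_intrinsicInterior {A : Type*} [NormedAddCommGroup A] [NormedSpace ℝ A]
    {K : Geometry.SimplicialComplex ℝ A} {σ s : Finset A} (hσ : σ ∈ K.faces) (hs : s ∈ K.faces)
    {a : A} (ha : a ∈ intrinsicInterior ℝ (convexHull ℝ (σ : Set A)))
    (has : a ∈ convexHull ℝ (s : Set A)) : σ ⊆ s := by
  classical
  intro u hu
  by_contra hus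
  have haσ := intrinsicInterior_subset ha
  have hzero : bary K u a = 0 := bary_eq_zero_of_notMem hs has hus
  -- a point `b` of the simplex such that `a` lies strictly between `b` and the vertex `u`
  obtain ⟨ε, hε, b, hbσ, hab⟩ : ∃ ε : ℝ, 0 < ε ∧ ∃ b ∈ convexHull ℝ (σ : Set A),
      (1 + ε) • a = b + ε • u := by
    obtain ⟨y, hy, hya⟩ := mem_intrinsicInterior.1 ha
    have huspan : u ∈ affineSpan ℝ (convexHull ℝ (σ : Set A)) :=
      subset_affineSpan ℝ _ (subset_convexHull ℝ _ hu)
    have hline : ∀ r : ℝ, AffineMap.lineMap a u r ∈ affineSpan ℝ (convexHull ℝ (σ : Set A)) :=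
      fun r => AffineMap.lineMap_mem r (hya ▸ y.2) huspan
    have hcont : Continuous fun r : ℝ => (⟨AffineMap.lineMap a u r, hline r⟩ :
        affineSpan ℝ (convexHull ℝ (σ : Set A))) :=
      AffineMap.lineMap_continuous.subtype_mk _
    have h0 : (⟨AffineMap.lineMap a u (0 : ℝ), hline 0⟩ :
        affineSpan ℝ (convexHull ℝ (σ : Set A))) = y := Subtype.ext (by simp [hya])
    have hnhds : ∀ᶠ r in nhds (0 : ℝ), AffineMap.lineMap a u r ∈ convexHull ℝ (σ : Set A) := by
      have h1 := mem_interior_iff_mem_nhds.1 hy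
      rw [← h0] at h1
      exact hcont.continuousAt h1
    obtain ⟨r, hr, hr0⟩ := ((hnhds.filter_mono nhdsWithin_le_nhds).and
      (self_mem_nhdsWithin (a := (0 : ℝ)) (s := Set.Iio 0))).exists
    refine ⟨-r, neg_pos.2 hr0, _, hr, ?_⟩
    simp only [AffineMap.lineMap_apply, vsub_eq_sub, vadd_eq_add]
    module
  obtain ⟨w, h0, h1, h2⟩ := Finset.mem_convexHull'.1 hbσ
  have hε1 : (1 + ε) ≠ 0 := by positivity
  have hb : IsBarycentric K a (fun v => if v ∈ σ then
      (1 + ε)⁻¹ * (w v + if v = u then ε else 0) else 0) := by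
    refine ⟨σ, hσ, fun v => ?_, fun v hv => if_neg hv, ?_, ?_⟩
    · by_cases hv : v ∈ σ
      · simp only [if_pos hv]
        have := h0 v hv
        have : 0 ≤ (if v = u then ε else 0) := by split_ifs <;> positivity
        positivity
      · simp [hv]
    · rw [Finset.sum_congr rfl fun v hv => if_pos hv, ← Finset.mul_sum, Finset.sum_add_distrib, h1]
      simp only [Finset.sum_ite_eq', hu, if_true]
      exact inv_mul_cancel₀ hε1
    · have hterm : ∀ v ∈ σ, (if v ∈ σ then (1 + ε)⁻¹ * (w v + if v = u then ε else 0) else 0) • v =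
          ((1 + ε)⁻¹ * (w v + if v = u then ε else 0)) • v := fun v hv => by rw [if_pos hv]
      rw [Finset.sum_congr rfl hterm]
      simp only [mul_smul, add_smul, ite_smul, zero_smul]
      rw [← Finset.smul_sum, Finset.sum_add_distrib, h2]
      simp only [Finset.sum_ite_eq', hu, if_true]
      rw [← hab, smul_smul, inv_mul_cancel₀ hε1, one_smul]
  rw [bary_eq hb, if_pos hu, if_pos rfl] at hzero
  have := h0 u hu
  have : 0 < (1 + ε)⁻¹ * (w u + ε) := by positivity
  exact this.ne' hzero

section Cells

variable {N : ℕ} {M : Type*} [TopologicalSpace M] [ChartedSpace (EuclideanSpace ℝ (Fin N)) M]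
  {A : Type*} [NormedAddCommGroup A] [NormedSpace ℝ A]
  {T : SmoothTriangulation N M A} {s : Finset A}

theorem isClosed_cell [T2Space M] (hs : s ∈ T.K.faces) : IsClosed (T.cell s) :=
  ((s.finite_toSet.isCompact_convexHull (𝕜 := ℝ)).image_of_continuousOn
    (T.continuousOn_map.mono (T.K.convexHull_subset_space hs))).isClosed

/-- Simplices have dimension at most `N`, since the triangulation is immersive on them. -/
theorem card_le_of_mem_faces (hs : s ∈ T.K.faces) : s.card ≤ N + 1 := by
  obtain ⟨u, hu⟩ := T.K.nonempty_of_mem_faces hs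
  have hfin := (T.K.indep hs).finrank_vectorSpan (n := s.card - 1) (by
    rw [Fintype.card_coe]
    have := Finset.card_pos.2 ⟨u, hu⟩
    omega)
  let L : A →L[ℝ] EuclideanSpace ℝ (Fin N) :=
    mfderivWithin 𝓘(ℝ, A) (𝓡 N) T.map (convexHull ℝ (s : Set A)) u
  have hinj : Function.Injective
      ((L : A →ₗ[ℝ] EuclideanSpace ℝ (Fin N)).domRestrict (vectorSpan ℝ (s : Set A))) := by
    rw [← LinearMap.ker_eq_bot, LinearMap.ker_eq_bot']
    intro w hw
    exact Subtype.ext (T.immersive_on_face s hs u (subset_convexHull ℝ _ hu) w w.2 hw)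
  have hle := LinearMap.finrank_le_finrank_of_injective hinj
  have h1 : Module.finrank ℝ (vectorSpan ℝ (s : Set A)) = s.card - 1 := by
    rw [← hfin]
    exact congrArg (fun S : Set A => Module.finrank ℝ (vectorSpan ℝ S)) Subtype.range_coe.symm
  rw [h1, finrank_euclideanSpace_fin] at hle
  omega

/-- A point of a cell with a vanishing barycentric coordinate lies in the opposite face. -/
theorem mem_cell_erase_of_cornerCoord_eq_zero [DecidableEq A] (hs : s ∈ T.K.faces)
    {v : Fin (N + 1) → A} (hv : Enumerates v s) {t : EuclideanSpace ℝ (Fin N)} (ht : t ∈ corner N)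
    {i : Fin (N + 1)} (hi : cornerCoord i t = 0) :
    s.erase (v i) ∈ T.K.faces ∧ T.cellMap v t ∈ T.cell (s.erase (v i)) := by
  have hsum : ∑ k ∈ Finset.univ.erase i, cornerCoord k t = 1 := by
    rw [Finset.sum_erase (f := fun k => cornerCoord k t) _ hi, sum_cornerCoord]
  have hmem : ∀ k ∈ Finset.univ.erase i, v k ∈ s.erase (v i) := fun k hk =>
    Finset.mem_erase.2 ⟨fun h => Finset.ne_of_mem_erase hk (hv.injective h), hv.mem k⟩
  have hne : (s.erase (v i)).Nonempty := by
    by_contra h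
    have hempty : (Finset.univ.erase i) = ∅ := by
      by_contra h'
      obtain ⟨k, hk⟩ := Finset.nonempty_iff_ne_empty.2 h'
      exact h ⟨_, hmem k hk⟩
    simp [hempty] at hsum
  refine ⟨T.K.down_closed hs (Finset.erase_subset _ _) hne, simplexMap v t, ?_, rfl⟩
  have hmap : simplexMap v t = ∑ k ∈ Finset.univ.erase i, cornerCoord k t • v k := by
    rw [Finset.sum_erase (f := fun k => cornerCoord k t • v k) _ (by rw [hi, zero_smul])]
    rfl
  rw [hmap]
  exact (convex_convexHull ℝ _).sum_mem (fun k _ => ht k) hsum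
    fun k hk => subset_convexHull ℝ _ (hmem k hk)

variable [IsManifold (𝓡 N) ∞ M] [RiemannianBundle (fun x : M => TangentSpace (𝓡 N) x)]
  [IsContMDiffRiemannianBundle (𝓡 N) ∞ (EuclideanSpace ℝ (Fin N))
    (fun x : M => TangentSpace (𝓡 N) x)]
  [MeasurableSpace M] [BorelSpace M] [T2Space M]

/-- Simplices of dimension less than `N` are null sets: they are images, under maps that are smooth
in charts, of subsets of a hyperplane of `ℝ^N`. -/
theorem chartVolume_cell_eq_zero (hs : s ∈ T.K.faces) (hcard : s.card ≤ N) (x₀ : M) :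
    chartVolume (N := N) x₀ (T.cell s) = 0 := by
  classical
  rw [chartVolume_eq_zero_iff x₀ (isClosed_cell hs).measurableSet]
  set χ := chartAt (EuclideanSpace ℝ (Fin N)) x₀ with hχ
  obtain ⟨u₀, hu₀⟩ := T.K.nonempty_of_mem_faces hs
  -- a list of `N + 1` vertices of `s`, with repetitions, in which the last place is superfluous
  let e := s.equivFin
  let v : Fin (N + 1) → A := fun i => if h : (i : ℕ) < s.card then e.symm ⟨i, h⟩ else u₀
  let r : A → Fin (N + 1) := fun u => if h : u ∈ s then
    ⟨e ⟨u, h⟩, (e ⟨u, h⟩).2.trans_le (hcard.trans (Nat.le_succ N))⟩ else 0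
  have hv : ∀ i, v i ∈ s := by
    intro i
    by_cases h : (i : ℕ) < s.card
    · simp only [v, dif_pos h]; exact (e.symm ⟨i, h⟩).2
    · simpa only [v, dif_neg h] using hu₀
  have hr : ∀ u ∈ s, v (r u) = u := by
    intro u hu
    have h : ((r u : Fin (N + 1)) : ℕ) = e ⟨u, hu⟩ := by simp [r, hu]
    have hlt : ((r u : Fin (N + 1)) : ℕ) < s.card := h ▸ (e ⟨u, hu⟩).2
    have hfin : (⟨(r u : Fin (N + 1)), hlt⟩ : Fin s.card) = e ⟨u, hu⟩ := Fin.ext h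
    simp only [v, dif_pos hlt, hfin, Equiv.symm_apply_apply]
  have hrl : ∀ u ∈ s, r u ≠ Fin.last N := by
    intro u hu h
    have h1 : ((r u : Fin (N + 1)) : ℕ) = e ⟨u, hu⟩ := by simp [r, hu]
    have h2 := (e ⟨u, hu⟩).2
    rw [h, Fin.val_last] at h1
    omega
  obtain ⟨j, hj⟩ : ∃ j : Fin N, j.succ = Fin.last N := by
    have hN : 0 < N := (Finset.card_pos.2 ⟨u₀, hu₀⟩).trans_le hcard
    exact ⟨⟨N - 1, by omega⟩, Fin.ext (by simp; omega)⟩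
  set Z : Set (EuclideanSpace ℝ (Fin N)) :=
    {t | t ∈ corner N ∧ t j = 0 ∧ T.cellMap v t ∈ χ.source} with hZ
  have hZ0 : volume Z = 0 := by
    have hker := Measure.addHaar_submodule (volume : Measure (EuclideanSpace ℝ (Fin N)))
      (LinearMap.ker (EuclideanSpace.proj j : EuclideanSpace ℝ (Fin N) →L[ℝ] ℝ).toLinearMap)
      (by
        intro h
        have : EuclideanSpace.single j (1 : ℝ) ∈ LinearMap.ker
            (EuclideanSpace.proj j : EuclideanSpace ℝ (Fin N) →L[ℝ] ℝ).toLinearMap := by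
          rw [h]; trivial
        simp at this)
    exact measure_mono_null (fun t ht => by simpa using ht.2.1) hker
  have hdiff : DifferentiableOn ℝ (fun t => χ (T.cellMap v t)) Z := by
    have h1 : ContMDiffOn 𝓘(ℝ, EuclideanSpace ℝ (Fin N)) 𝓘(ℝ, EuclideanSpace ℝ (Fin N)) ∞
        (fun t => χ (T.cellMap v t)) Z :=
      (contMDiffOn_chart (I := 𝓡 N) (x := x₀)).comp
        ((SmoothTriangulation.contMDiffOn_cellMap hs hv).mono fun t ht => ht.1)
        fun t ht => ht.2.2
    exact (contMDiffOn_iff_contDiffOn.1 h1).differentiableOn (by simp)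
  refine measure_mono_null ?_
    (addHaar_image_eq_zero_of_differentiableOn_of_addHaar_eq_zero volume hdiff hZ0)
  rintro z ⟨hzt, a, ha, haz⟩
  obtain ⟨t, ht, hta, htz⟩ := exists_simplexMap_eq hr ha
  have hcell : T.cellMap v t = χ.symm z := by rw [SmoothTriangulation.cellMap, hta, haz]
  refine ⟨t, ⟨ht, ?_, ?_⟩, ?_⟩
  · have h1 := htz (Fin.last N) hrl
    rwa [← hj, cornerCoord_succ] at h1
  · rw [hcell]; exact χ.map_target hzt
  · change χ (T.cellMap v t) = z
    rw [hcell, χ.right_inv hzt]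

variable (T) in
/-- Almost every point lies in the interior of a top-dimensional cell, the other points being in
one of the finitely many cells of smaller dimension. -/
theorem ae_mem_image_openCorner [SigmaCompactSpace M] :
    ∀ᵐ x ∂riemannianVolume N M, ∃ s ∈ T.K.faces, ∃ v : Fin (N + 1) → A, Enumerates v s ∧
      x ∈ T.cellMap v '' openCorner N := by
  classical
  have hnull : ∀ᵐ x ∂riemannianVolume N M, ∀ s ∈ T.K.faces, s.card ≤ N → x ∉ T.cell s := by
    rw [ae_ball_iff T.finite_faces.countable]
    intro s hs
    by_cases hcard : s.card ≤ N
    · have h0 := riemannianVolume_eq_zero (isClosed_cell hs).measurableSet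
        (chartVolume_cell_eq_zero hs hcard)
      filter_upwards [measure_eq_zero_iff_ae_notMem.1 h0] with x hx _ using hx
    · exact Filter.Eventually.of_forall fun x h => absurd h hcard
  filter_upwards [hnull] with x hx
  obtain ⟨s, hs, hxs⟩ := Geometry.SimplicialComplex.mem_space_iff.1 (T.inv_mem x)
  have hcard : s.card = N + 1 := by
    have h1 := card_le_of_mem_faces hs
    have h2 : ¬ s.card ≤ N := fun h => hx s hs h ⟨_, hxs, T.map_inv x⟩
    omega
  obtain ⟨v, hv⟩ := exists_enumerates hcard
  obtain ⟨t, ht, hta⟩ := hv.exists_simplexMap_eq hxs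
  have hxt : T.cellMap v t = x := by rw [SmoothTriangulation.cellMap, hta, T.map_inv]
  refine ⟨s, hs, v, hv, t, fun i => lt_of_le_of_ne (ht i) fun h0 => ?_, hxt⟩
  obtain ⟨h1, h2⟩ := mem_cell_erase_of_cornerCoord_eq_zero hs hv ht h0.symm
  refine hx _ h1 ?_ (hxt ▸ h2)
  rw [Finset.card_erase_of_mem (hv.mem i), hcard]
  omega

/-- Every simplex lies in a top-dimensional one: the union of the top-dimensional cells is closed
and dense, hence contains the interior points of the simplex. -/
theorem exists_top_simplex [SigmaCompactSpace M] {σ : Finset A} (hσ : σ ∈ T.K.faces) {x : M}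
    (hx : x ∈ T.map '' intrinsicInterior ℝ (convexHull ℝ (σ : Set A))) :
    ∃ s ∈ T.K.faces, σ ⊆ s ∧ ∃ v : Fin (N + 1) → A, Enumerates v s := by
  set Z : Set M := ⋃ s ∈ {s ∈ T.K.faces | ∃ v : Fin (N + 1) → A, Enumerates v s}, T.cell s with hZ
  have hclosed : IsClosed Z :=
    (T.finite_faces.subset fun s hs => hs.1).isClosed_biUnion fun s hs => isClosed_cell hs.1
  have hdense : Dense Z := by
    refine (dense_of_ae_riemannianVolume (ae_mem_image_openCorner T)).mono ?_
    rintro y ⟨s, hs, v, hv, t, ht, rfl⟩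
    exact Set.mem_biUnion (show s ∈ {s ∈ T.K.faces | ∃ v : Fin (N + 1) → A, Enumerates v s} from
      ⟨hs, v, hv⟩) ⟨_, simplexMap_mem hv.mem (openCorner_subset ht), rfl⟩
  have hxZ : x ∈ Z := by
    rw [← hclosed.closure_eq]
    exact hdense x
  obtain ⟨s, ⟨hs, hv⟩, a, has, hax⟩ := Set.mem_iUnion₂.1 hxZ
  obtain ⟨b, hb, hbx⟩ := hx
  have hab : a = b := by
    rw [← T.inv_map a (T.K.convexHull_subset_space hs has),
      ← T.inv_map b (T.K.convexHull_subset_space hσ (intrinsicInterior_subset hb)), hax, hbx]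
  exact ⟨s, hs, subset_of_mem_intrinsicInterior hσ hs hb (hab ▸ has), hv⟩

end Cells

/-! ### Integrability, linearity and injectivity -/

section Integrability

variable {N : ℕ} {M : Type*} [TopologicalSpace M] [ChartedSpace (EuclideanSpace ℝ (Fin N)) M]
  {A : Type*} [NormedAddCommGroup A] [NormedSpace ℝ A]
  {T : SmoothTriangulation N M A} {s : Finset A} {v : Fin (N + 1) → A}
  [RiemannianBundle (fun x : M => TangentSpace (𝓡 N) x)]

variable (T) in
/-- The Gram matrix of the coordinate vector fields of a top-dimensional cell. -/
def cellGram (v : Fin (N + 1) → A) (t : EuclideanSpace ℝ (Fin N)) : Matrix (Fin N) (Fin N) ℝ :=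
  Matrix.gram ℝ fun i : Fin N =>
    mfderivWithin 𝓘(ℝ, EuclideanSpace ℝ (Fin N)) (𝓡 N) (T.cellMap v) (corner N) t
      (EuclideanSpace.single i (1 : ℝ))

theorem det_cellGram_pos (hs : s ∈ T.K.faces) (hv : Enumerates v s)
    {t : EuclideanSpace ℝ (Fin N)} (ht : t ∈ corner N) : 0 < (cellGram T v t).det := by
  let L : EuclideanSpace ℝ (Fin N) →ₗ[ℝ] TangentSpace (𝓡 N) (T.cellMap v t) :=
    (mfderivWithin 𝓘(ℝ, EuclideanSpace ℝ (Fin N)) (𝓡 N) (T.cellMap v) (corner N) t).toLinearMap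
  refine det_gram_pos L ?_
  rw [← LinearMap.ker_eq_bot, LinearMap.ker_eq_bot']
  exact fun w hw => SmoothTriangulation.mfderivWithin_cellMap_injective hs hv ht hw

theorem continuousOn_inv_cellGram [IsManifold (𝓡 N) ∞ M]
    [IsContMDiffRiemannianBundle (𝓡 N) ∞ (EuclideanSpace ℝ (Fin N))
      (fun x : M => TangentSpace (𝓡 N) x)] (hs : s ∈ T.K.faces) (hv : Enumerates v s) :
    ContinuousOn (fun t => (cellGram T v t)⁻¹) (corner N) := by
  rw [continuousOn_iff_continuous_domRestrict]
  have h1 : Continuous fun t : corner N => cellGram T v t := continuous_matrix fun i j =>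
    continuousOn_iff_continuous_domRestrict.1 (continuousOn_inner_mfderivWithin
      (SmoothTriangulation.contMDiffOn_cellMap hs hv.mem) SmoothTriangulation.uniqueMDiffOn_corner
      (EuclideanSpace.single i (1 : ℝ)) (EuclideanSpace.single j (1 : ℝ)))
  refine Continuous.congr (f := fun t : corner N =>
    ((cellGram T v t).det)⁻¹ • (cellGram T v t).adjugate) ?_ fun t => ?_
  · exact (h1.matrix_det.inv₀ fun t => (det_cellGram_pos hs hv t.2).ne').smul h1.matrix_adjugate
  · rw [Set.domRestrict_apply, Matrix.inv_def, Ring.inverse_eq_inv']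

/-- The pointwise inner product of two forms on an open top-dimensional cell, in terms of their
components with respect to the coordinate vector fields of the cell. -/
theorem formInner_cellMap {V : Type*} [NormedAddCommGroup V] [InnerProductSpace ℂ V] {q : ℕ}
    (hs : s ∈ T.K.faces) (hv : Enumerates v s) {t : EuclideanSpace ℝ (Fin N)}
    (ht : t ∈ openCorner N)
    (α β : TangentSpace (𝓡 N) (T.cellMap v t) [⋀^Fin q]→ₗ[ℝ] V) :
    formInner (T.cellMap v t) α β = ((q ! : ℕ) : ℂ)⁻¹ * ∑ I : Fin q → Fin N, ∑ I' : Fin q → Fin N,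
      ((∏ k, (cellGram T v t)⁻¹ (I k) (I' k) : ℝ) : ℂ) *
        inner ℂ
          (α fun k => mfderiv 𝓘(ℝ, EuclideanSpace ℝ (Fin N)) (𝓡 N) (T.cellMap v) t
            (EuclideanSpace.single (I k) (1 : ℝ)))
          (β fun k => mfderiv 𝓘(ℝ, EuclideanSpace ℝ (Fin N)) (𝓡 N) (T.cellMap v) t
            (EuclideanSpace.single (I' k) (1 : ℝ))) := by
  let L : EuclideanSpace ℝ (Fin N) →ₗ[ℝ] TangentSpace (𝓡 N) (T.cellMap v t) :=
    (mfderiv 𝓘(ℝ, EuclideanSpace ℝ (Fin N)) (𝓡 N) (T.cellMap v) t).toLinearMap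
  have hL : Function.Injective L := by
    rw [← LinearMap.ker_eq_bot, LinearMap.ker_eq_bot']
    exact fun w hw => SmoothTriangulation.mfderiv_cellMap_injective hs hv ht hw
  let e : EuclideanSpace ℝ (Fin N) ≃ₗ[ℝ] TangentSpace (𝓡 N) (T.cellMap v t) :=
    LinearEquiv.ofInjectiveOfFinrankEq L hL rfl
  let f : Module.Basis (Fin N) ℝ (TangentSpace (𝓡 N) (T.cellMap v t)) :=
    (EuclideanSpace.basisFun (Fin N) ℝ).toBasis.map e
  have hf : ∀ i, f i = mfderiv 𝓘(ℝ, EuclideanSpace ℝ (Fin N)) (𝓡 N) (T.cellMap v) t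
      (EuclideanSpace.single i (1 : ℝ)) := by
    intro i
    change L ((EuclideanSpace.basisFun (Fin N) ℝ).toBasis i) = _
    rw [OrthonormalBasis.coe_toBasis, EuclideanSpace.basisFun_apply]
    rfl
  have hgram : Matrix.gram ℝ f = cellGram T v t := by
    unfold cellGram
    rw [mfderivWithin_of_mem_nhds (openCorner_mem_nhds ht)]
    exact congrArg (Matrix.gram ℝ) (funext hf)
  rw [formInner_eq_of_basis f, hgram]
  simp only [hf]

variable [IsManifold (𝓡 N) ∞ M]
  [IsContMDiffRiemannianBundle (𝓡 N) ∞ (EuclideanSpace ℝ (Fin N))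
    (fun x : M => TangentSpace (𝓡 N) x)]
  {F : Type*} [NormedAddCommGroup F] [NormedSpace ℂ F] [FiniteDimensional ℂ F]
  {E : M → Type*} [TopologicalSpace (TotalSpace F E)]
  [∀ x, NormedAddCommGroup (E x)] [∀ x, InnerProductSpace ℂ (E x)]
  [FiberBundle F E] [VectorBundle ℂ F E] [∀ x, FiniteDimensional ℂ (E x)]
  {T₀ : SmoothTriangulation N M A} {ι : Type*} [Fintype ι]

/-- On an open top-dimensional cell, the pointwise inner product of two forms `i^* W I c` extends
continuously to the compact parameter domain of the closed cell. -/
theorem exists_continuousOn_formInner_twistedWhitney (D : EmbeddingData T₀ F E ι)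
    (hs : s ∈ T.K.faces) (hv : Enumerates v s) {m : T.Marking} {q : ℕ}
    (c c' : TwistedCochain m E q) :
    ∃ H : EuclideanSpace ℝ (Fin N) → ℂ, ContinuousOn H (corner N) ∧ ∀ t ∈ openCorner N,
      formInner (T.cellMap v t) (twistedWhitney D c (T.cellMap v t))
        (twistedWhitney D c' (T.cellMap v t)) = H t := by
  set g : (Fin q → Fin N) → T.Simplex q → EuclideanSpace ℝ (Fin N) → ℝ := fun I σ t =>
    whitneyCoord v (fun i => (m.order σ i : A)) t
      fun k => EuclideanSpace.single (I k) (1 : ℝ) with hg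
  have hgc : ∀ I σ, Continuous (g I σ) := fun I σ => continuous_whitneyCoord v _ _
  refine ⟨fun t => ((q ! : ℕ) : ℂ)⁻¹ * ∑ I : Fin q → Fin N, ∑ I' : Fin q → Fin N,
    ((∏ k, (cellGram T v t)⁻¹ (I k) (I' k) : ℝ) : ℂ) *
      ∑ σ', ∑ σ, ((g I' σ' t : ℂ) * (g I σ t : ℂ)) *
        inner ℂ (LinearMap.adjoint (D.i (T.cellMap v t)) (twistI D c σ))
          (LinearMap.adjoint (D.i (T.cellMap v t)) (twistI D c' σ')), ?_, ?_⟩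
  · refine continuousOn_const.mul (continuousOn_finsetSum _ fun I _ =>
      continuousOn_finsetSum _ fun I' _ => ContinuousOn.mul ?_ ?_)
    · refine Complex.continuous_ofReal.comp_continuousOn (continuousOn_finsetProd _ fun k _ => ?_)
      exact (continuous_id.matrix_elem (I k) (I' k)).comp_continuousOn
        (continuousOn_inv_cellGram hs hv)
    · refine continuousOn_finsetSum _ fun σ' _ => continuousOn_finsetSum _ fun σ _ =>
        ContinuousOn.mul ?_ ?_
      · exact ((Complex.continuous_ofReal.comp (hgc I' σ')).mul
          (Complex.continuous_ofReal.comp (hgc I σ))).continuousOn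
      · exact (D.continuous_inner_adjoint_i _ _).comp_continuousOn
          (SmoothTriangulation.contMDiffOn_cellMap hs hv.mem).continuousOn
  · intro t ht
    have hval : ∀ (c : TwistedCochain m E q) (I : Fin q → Fin N),
        twistedWhitney D c (T.cellMap v t) (fun k =>
          mfderiv 𝓘(ℝ, EuclideanSpace ℝ (Fin N)) (𝓡 N) (T.cellMap v) t
            (EuclideanSpace.single (I k) (1 : ℝ))) =
        ∑ σ, (g I σ t : ℂ) • LinearMap.adjoint (D.i (T.cellMap v t)) (twistI D c σ) := by
      intro c I
      have h := whitneyMap_cellMap hs hv m (twistI D c) ht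
        fun k => EuclideanSpace.single (I k) (1 : ℝ)
      refine (congrArg (LinearMap.adjoint (D.i (T.cellMap v t))) h).trans ?_
      rw [map_sum]
      refine Finset.sum_congr rfl fun σ _ => ?_
      rw [RCLike.real_smul_eq_coe_smul (K := ℂ), map_smul]
      rfl
    rw [formInner_cellMap hs hv ht]
    simp only [hval, sum_inner, inner_sum, inner_smul_left, inner_smul_right, Complex.conj_ofReal,
      mul_assoc, Finset.mul_sum]

variable [MeasurableSpace M] [BorelSpace M] [T2Space M] [CompactSpace M]

/-- On an open top-dimensional cell the pointwise inner product is continuous and bounded, since it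
comes from a continuous function on the compact parameter domain. -/
theorem integrableOn_formInner_twistedWhitney (D : EmbeddingData T₀ F E ι)
    (hs : s ∈ T.K.faces) (hv : Enumerates v s) {m : T.Marking} {q : ℕ}
    (c c' : TwistedCochain m E q) :
    IntegrableOn (fun x => formInner x (twistedWhitney D c x) (twistedWhitney D c' x))
      (T.cellMap v '' openCorner N) (riemannianVolume N M) := by
  have := isFiniteMeasure_riemannianVolume (N := N) (M := M)
  obtain ⟨H, hH, hHeq⟩ := exists_continuousOn_formInner_twistedWhitney D hs hv c c'
  have hO := SmoothTriangulation.isOpen_image_cellMap hs hv isOpen_openCorner subset_rfl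
  obtain ⟨C, hC⟩ := isCompact_corner.exists_bound_of_continuousOn hH
  have hcont : ContinuousOn
      (fun x => formInner x (twistedWhitney D c x) (twistedWhitney D c' x))
      (T.cellMap v '' openCorner N) := by
    rintro _ ⟨t, ht, rfl⟩
    -- near `T.cellMap v t` the function is `H` composed with a local inverse of the parametrization
    obtain ⟨G, hG1, hG2, hG3⟩ := exists_local_right_inverse
      (SmoothTriangulation.contMDiffAt_cellMap hs hv.mem ht)
      (fun w => SmoothTriangulation.mfderiv_cellMap_injective hs hv ht)
    have hHt : ContinuousAt H (G (T.cellMap v t)) := by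
      rw [hG1]
      exact hH.continuousAt (openCorner_mem_nhds ht)
    have hGt : ∀ᶠ y in nhds (T.cellMap v t), G y ∈ openCorner N :=
      hG2.continuousAt.eventually (by rw [hG1]; exact isOpen_openCorner.mem_nhds ht)
    refine ContinuousAt.continuousWithinAt
      ((ContinuousAt.comp (g := H) hHt hG2.continuousAt).congr ?_)
    filter_upwards [hGt, hG3] with y hy1 hy2
    rw [Function.comp_apply, ← hHeq _ hy1, hy2]
  refine Integrable.of_bound (hcont.aestronglyMeasurable hO.measurableSet) C ?_
  filter_upwards [ae_restrict_mem hO.measurableSet]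
  rintro _ ⟨t, ht, rfl⟩
  rw [hHeq t ht]
  exact hC t (openCorner_subset ht)

theorem integrable_formInner_twistedWhitney (D : EmbeddingData T₀ F E ι) {m : T.Marking} {q : ℕ}
    (c c' : TwistedCochain m E q) :
    Integrable (fun x => formInner x (twistedWhitney D c x) (twistedWhitney D c' x))
      (riemannianVolume N M) := by
  have hfin : {v : Fin (N + 1) → A | ∃ s ∈ T.K.faces, Enumerates v s}.Finite := by
    refine (T.finite_faces.biUnion fun s _ => Set.Finite.pi' fun _ : Fin (N + 1) =>
      s.finite_toSet).subset ?_
    rintro v ⟨s, hs, hv⟩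
    exact Set.mem_biUnion hs fun i => hv.mem i
  have hint := (integrableOn_finite_biUnion hfin).2 fun v ⟨s, hs, hv⟩ =>
    integrableOn_formInner_twistedWhitney D hs hv c c'
  rwa [IntegrableOn, Measure.restrict_eq_self_of_ae_mem] at hint
  filter_upwards [ae_mem_image_openCorner T] with x ⟨s, hs, v, hv, hx⟩
  exact Set.mem_biUnion (show v ∈ {v | ∃ s ∈ T.K.faces, Enumerates v s} from ⟨s, hs, hv⟩) hx

end Integrability

section Linearity

variable {N : ℕ} {M : Type*} [EMetricSpace M] [ChartedSpace (EuclideanSpace ℝ (Fin N)) M]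
  {A : Type*} [NormedAddCommGroup A] [NormedSpace ℝ A]
  {T : SmoothTriangulation N M A}
  {F : Type*} [NormedAddCommGroup F] [NormedSpace ℂ F]
  {E : M → Type*} [TopologicalSpace (TotalSpace F E)]
  [∀ x, NormedAddCommGroup (E x)] [∀ x, InnerProductSpace ℂ (E x)]
  [FiberBundle F E]
  {T₀ : SmoothTriangulation N M A} {ι : Type*} [Fintype ι] (D : EmbeddingData T₀ F E ι)

theorem EmbeddingData.meanEmbedding_add {κ : Type*} [Fintype κ] (S : Set M) (y : κ → M) {p : M}
    (u u' : E p) :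
    D.meanEmbedding S y (u + u') = D.meanEmbedding S y u + D.meanEmbedding S y u' := by
  ext1 l
  by_cases h : S ⊆ closure (D.U l)
  · simp [meanEmbedding, h, add_smul, Finset.sum_add_distrib]
  · simp [meanEmbedding, h]

theorem EmbeddingData.meanEmbedding_smul {κ : Type*} [Fintype κ] (S : Set M) (y : κ → M) {p : M}
    (a : ℂ) (u : E p) : D.meanEmbedding S y (a • u) = a • D.meanEmbedding S y u := by
  ext1 l
  by_cases h : S ⊆ closure (D.U l)
  · simp [meanEmbedding, h, mul_smul, ← Finset.smul_sum, smul_comm _ a]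
  · simp [meanEmbedding, h]

variable [∀ x, FiniteDimensional ℂ (E x)] {m : T.Marking} {q : ℕ}

theorem twistedWhitney_apply (c : TwistedCochain m E q) (x : M)
    (w : Fin q → TangentSpace (𝓡 N) x) :
    twistedWhitney D c x w = ∑ σ, (whitneyForm T (fun i => (m.order σ i : A)) x w : ℂ) •
      LinearMap.adjoint (D.i x) (twistI D c σ) := by
  change LinearMap.adjoint (D.i x) (whitneyMap T m (twistI D c) x w) = _
  rw [whitneyMap, alternatingMap_sum_apply, map_sum]
  refine Finset.sum_congr rfl fun σ _ => ?_
  change LinearMap.adjoint (D.i x)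
    (whitneyForm T (fun i => (m.order σ i : A)) x w • twistI D c σ) = _
  rw [RCLike.real_smul_eq_coe_smul (K := ℂ), map_smul]
  rfl

theorem twistedWhitney_add (c c' : TwistedCochain m E q) (x : M) :
    twistedWhitney D (c + c') x = twistedWhitney D c x + twistedWhitney D c' x := by
  ext w
  simp only [AlternatingMap.add_apply, twistedWhitney_apply, twistI_apply, Pi.add_apply,
    D.meanEmbedding_add, map_add, smul_add, Finset.sum_add_distrib]

theorem twistedWhitney_smul (a : ℂ) (c : TwistedCochain m E q) (x : M) :
    twistedWhitney D (a • c) x = a • twistedWhitney D c x := by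
  ext w
  simp only [AlternatingMap.smul_apply, twistedWhitney_apply, twistI_apply, Pi.smul_apply,
    D.meanEmbedding_smul, map_smul, Finset.smul_sum, smul_comm a]

theorem twistedWhitney_sub (c c' : TwistedCochain m E q) (x : M) :
    twistedWhitney D (c - c') x = twistedWhitney D c x - twistedWhitney D c' x := by
  rw [eq_sub_iff_add_eq, ← twistedWhitney_add, sub_add_cancel]

end Linearity

section Injectivity

variable {N : ℕ} {M : Type*} [EMetricSpace M] [CompactSpace M]
  [ChartedSpace (EuclideanSpace ℝ (Fin N)) M] [IsManifold (𝓡 N) ∞ M]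
  [RiemannianBundle (fun x : M => TangentSpace (𝓡 N) x)]
  [IsContMDiffRiemannianBundle (𝓡 N) ∞ (EuclideanSpace ℝ (Fin N))
    (fun x : M => TangentSpace (𝓡 N) x)] [MeasurableSpace M] [BorelSpace M]
  {F : Type*} [NormedAddCommGroup F] [NormedSpace ℂ F]
  {E : M → Type*} [TopologicalSpace (TotalSpace F E)]
  [∀ x, NormedAddCommGroup (E x)] [∀ x, InnerProductSpace ℂ (E x)]
  [∀ x, FiniteDimensional ℂ (E x)] [FiberBundle F E] [VectorBundle ℂ F E]
  {A : Type*} [NormedAddCommGroup A] [NormedSpace ℝ A]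
  {T₀ : SmoothTriangulation N M A} {ι : Type*} [Fintype ι] (D : EmbeddingData T₀ F E ι)

/-- On fine triangulations, the twisted Whitney map has trivial kernel modulo null sets. -/
theorem exists_delta_eq_zero_of_ae_twistedWhitney_eq_zero :
    ∃ δ : ℝ, 0 < δ ∧ ∀ T : SmoothTriangulation N M A, T.mesh < ENNReal.ofReal δ →
      ∀ (m : T.Marking) (q : ℕ) (c : TwistedCochain m E q),
        (∀ᵐ x ∂riemannianVolume N M, twistedWhitney D c x = 0) → c = 0 := by
  obtain ⟨δ, hδ, h⟩ := D.exists_delta_meanEmbedding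
  refine ⟨δ, hδ, fun T hT m q c hc => funext fun σ => ?_⟩
  obtain ⟨s, hs, hσs, v, hv⟩ := exists_top_simplex σ.2.1 (m.refPoint_mem σ)
  have hdense : Dense {x | ∀ w, LinearMap.adjoint (D.i x) (whitneyMap T m (twistI D c) x w) = 0} :=
    dense_of_ae_riemannianVolume (hc.mono fun x hx w =>
      congrArg (fun α : TangentSpace (𝓡 N) x [⋀^Fin q]→ₗ[ℝ] E x => α w) hx)
  have hzero := adjoint_apply_eq_zero_of_dense D hs hv m (twistI D c) hdense hσs
  rw [twistI_apply] at hzero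
  have hdiam : Metric.ediam (T.cell σ.1) < ENNReal.ofReal δ :=
    lt_of_le_of_lt (le_iSup₂ (f := fun s (_ : s ∈ T.K.faces) => Metric.ediam (T.cell s))
      σ.1 σ.2.1) hT
  have : Nonempty {u // u ∈ σ.1} := (T.K.nonempty_of_mem_faces σ.2.1).to_subtype
  refine h _ hdiam _ (fun u => ?_) _ ?_ _ hzero
  · exact ⟨u, subset_convexHull ℝ _ u.2, rfl⟩
  · exact Set.image_mono intrinsicInterior_subset (m.refPoint_mem σ)

end Injectivity

end TwistedWhitney

end

theorem lemma4p1
    -- a closed Riemannian manifold `M` of dimension `N`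
    {N : ℕ} {M : Type*} [EMetricSpace M] [CompactSpace M]
    [ChartedSpace (EuclideanSpace ℝ (Fin N)) M] [IsManifold (𝓡 N) ∞ M]
    [RiemannianBundle (fun x : M => TangentSpace (𝓡 N) x)]
    [IsContMDiffRiemannianBundle (𝓡 N) ∞ (EuclideanSpace ℝ (Fin N))
      (fun x : M => TangentSpace (𝓡 N) x)]
    [IsRiemannianManifold (𝓡 N) M] [MeasurableSpace M] [BorelSpace M]
    -- a smooth Hermitian complex vector bundle `E` over `M` with model fibre `F`
    {F : Type*} [NormedAddCommGroup F] [NormedSpace ℂ F] [FiniteDimensional ℂ F]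
    {E : M → Type*} [TopologicalSpace (TotalSpace F E)]
    [∀ x, NormedAddCommGroup (E x)] [∀ x, InnerProductSpace ℂ (E x)]
    [∀ x, FiniteDimensional ℂ (E x)]
    [FiberBundle F E] [VectorBundle ℂ F E] [VectorBundle ℝ F E]
    [ContMDiffVectorBundle ∞ F E (𝓡 N)] [TwistedWhitney.IsSmoothHermitian N F E]
    -- the initial triangulation and the embedding of `E` into a trivial bundle
    {A : Type*} [NormedAddCommGroup A] [NormedSpace ℝ A] [FiniteDimensional ℝ A]
    (T₀ : TwistedWhitney.SmoothTriangulation N M A)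
    {ι : Type*} [Fintype ι] (D : TwistedWhitney.EmbeddingData T₀ F E ι) :
    ∃ δ : ℝ, 0 < δ ∧ ∀ T : TwistedWhitney.SmoothTriangulation N M A,
      T.IsSubdivision T₀ → T.mesh < ENNReal.ofReal δ →
      ∀ (m : T.Marking) (q : ℕ),
        -- injectivity of the twisted Whitney map into `L²`, i.e. modulo null sets
        (∀ c c' : TwistedWhitney.TwistedCochain m E q,
          (∀ᵐ x ∂(TwistedWhitney.riemannianVolume N M),
            TwistedWhitney.twistedWhitney D c x = TwistedWhitney.twistedWhitney D c' x) →
          c = c') ∧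
        -- the twisted Whitney inner product is a well defined inner product
        (∀ c c' : TwistedWhitney.TwistedCochain m E q,
          Integrable (fun x => TwistedWhitney.formInner x (TwistedWhitney.twistedWhitney D c x)
            (TwistedWhitney.twistedWhitney D c' x)) (TwistedWhitney.riemannianVolume N M)) ∧
        ∃ P : InnerProductSpace.Core ℂ (TwistedWhitney.TwistedCochain m E q),
          ∀ c c' : TwistedWhitney.TwistedCochain m E q,
            P.inner c c' = ∫ x, TwistedWhitney.formInner x (TwistedWhitney.twistedWhitney D c x)
              (TwistedWhitney.twistedWhitney D c' x) ∂(TwistedWhitney.riemannianVolume N M) := by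
  obtain ⟨δ, hδ, hinj⟩ :=
    TwistedWhitney.exists_delta_eq_zero_of_ae_twistedWhitney_eq_zero D
  refine ⟨δ, hδ, fun T _ hT m q => ?_⟩
  have hint := TwistedWhitney.integrable_formInner_twistedWhitney D (m := m) (q := q)
  refine ⟨fun c c' h => sub_eq_zero.1 (hinj T hT m q _ ?_), hint, ?_⟩
  · filter_upwards [h] with x hx
    rw [TwistedWhitney.twistedWhitney_sub, hx, sub_self]
  choose r hr0 hr hr1 using fun (c : TwistedWhitney.TwistedCochain m E q) (x : M) =>
    TwistedWhitney.formInner_self_eq (TwistedWhitney.twistedWhitney D c x)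
  have hself : ∀ c : TwistedWhitney.TwistedCochain m E q,
      ∫ x, TwistedWhitney.formInner x (TwistedWhitney.twistedWhitney D c x)
        (TwistedWhitney.twistedWhitney D c x) ∂(TwistedWhitney.riemannianVolume N M) =
      ((∫ x, r c x ∂(TwistedWhitney.riemannianVolume N M) : ℝ) : ℂ) := by
    intro c
    simp only [hr]
    exact integral_ofReal
  refine ⟨{ inner := fun c c' => ∫ x, TwistedWhitney.formInner x
              (TwistedWhitney.twistedWhitney D c x) (TwistedWhitney.twistedWhitney D c' x)
              ∂(TwistedWhitney.riemannianVolume N M)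
            conj_inner_symm := fun c c' => ?_
            re_inner_nonneg := fun c => ?_
            add_left := fun c c' c'' => ?_
            smul_left := fun c c' a => ?_
            definite := fun c hc => ?_ }, fun c c' => rfl⟩
  · refine integral_conj.symm.trans (integral_congr_ae (.of_forall fun x => ?_))
    exact TwistedWhitney.star_formInner _ _
  · change 0 ≤ Complex.re (∫ x, _ ∂_)
    rw [hself, Complex.ofReal_re]
    exact integral_nonneg (hr0 c)
  · refine Eq.trans (integral_congr_ae (.of_forall fun x => ?_))
      (integral_add (hint c c'') (hint c' c''))
    change TwistedWhitney.formInner x (TwistedWhitney.twistedWhitney D (c + c') x) _ = _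
    rw [TwistedWhitney.twistedWhitney_add, TwistedWhitney.formInner_add_left]
  · refine Eq.trans (integral_congr_ae (.of_forall fun x => ?_)) (integral_const_mul _ _)
    change TwistedWhitney.formInner x (TwistedWhitney.twistedWhitney D (a • c) x) _ = _
    rw [TwistedWhitney.twistedWhitney_smul, TwistedWhitney.formInner_smul_left]
    rfl
  · -- a nonnegative function with zero integral vanishes almost everywhere
    have h0 : ∫ x, r c x ∂(TwistedWhitney.riemannianVolume N M) = 0 := by
      rw [← Complex.ofReal_eq_zero, ← hself c]
      exact hc
    have hri : Integrable (r c) (TwistedWhitney.riemannianVolume N M) :=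
      (hint c c).re.congr (.of_forall fun x => by simp [hr])
    refine hinj T hT m q c ?_
    filter_upwards [(integral_eq_zero_iff_of_nonneg (hr0 c) hri).1 h0] with x hx
    exact hr1 c x hx
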